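/- For $d\ge 3$ and $\lambda>0$ let $\alpha=\alpha(\lambda,d)$ be the unique solution in $(0,\tfrac12)$ of $$\lambda=\frac{\alpha}{1-2\alpha}\Bigl(\frac{1-\alpha}{1-2\alpha}\Bigr)^{d-1},$$ and let $\mathbb P_{T_d}$ be the translation invariant hardcore measure with fugacity $\lambda$ on the infinite $d$-regular tree $T_d$ rooted at $\rho$, that is, the law of the Markov model in which the root is occupied (spin $1$) with probability $\alpha$ and unoccupied (spin $0$) otherwise, and, going away from the root, each other vertex is unoccupied if its parent is occupied and is occupied with probability $\frac{\alpha}{1-\alpha}$ if its parent is unoccupied, independently given the spins generated before. Let $\sigma(L)$ be the spins of the vertices at distance $L$ from $\rho$. Non-reconstruction holds at $\lambda$ if $\mathbb P_{T_d}(\sigma_\rho=1\mid\sigma(L))\to\alpha(\lambda,d)$ in probability as $L\to\infty$; otherwise reconstruction holds. **Theorem.** For all large enough $d$ there is a critical fugacity $\lambda_R=\lambda_R(d)\in(0,\infty)$ such that non-reconstruction holds for $0<\lambda<\lambda_R$ and reconstruction holds for $\lambda>\lambda_R$, and, with $o(1)$ denoting quantities that tend to $0$ as $d\to\infty$, $$\frac{(\ln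 2-o(1))\ln^2 d}{2\ln\ln d}\le\lambda_R\le(e+o(1))\ln^2 d .$$ Equivalently, the critical density $\alpha_R=\alpha(\lambda_R,d)$ satisfies $$\frac1d\bigl(\ln d+\ln\ln d-\ln\ln\ln d-\ln 2+\ln\ln 2-o(1)\bigr)\le\alpha_R\le\frac1d\bigl(\ln d+\ln\ln d+1+o(1)\bigr).$$ -/

import Mathlib

open Real Filter Topology MeasureTheory

noncomputable section

namespace Hardcore

/-! ### Fugacity and density -/

/-- The fugacity of the translation invariant hardcore measure of density `α` on the `d`-regular
tree, `λ = α / (1 - 2α) * ((1 - α) / (1 - 2α)) ^ (d - 1)` (used for `1 ≤ d` and `0 < α < 1/2`). -/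
def fugacity (d : ℕ) (α : ℝ) : ℝ :=
  α / (1 - 2 * α) * ((1 - α) / (1 - 2 * α)) ^ (d - 1)

theorem existsUnique_density (d : ℕ) {lam : ℝ} (hlam : 0 < lam) :
    ∃! α : ℝ, 0 < α ∧ α < 1 / 2 ∧ fugacity d α = lam := by
  have hmono : ∀ a b : ℝ, 0 < a → a < b → b < 1 / 2 → fugacity d a < fugacity d b := by
    intro a b ha hab hb
    unfold fugacity
    have h1 : 0 < 1 - 2 * a := by linarith
    have h2 : 0 < 1 - 2 * b := by linarith
    have e1 : a / (1 - 2 * a) < b / (1 - 2 * b) := by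
      rw [div_lt_div_iff₀ h1 h2]; nlinarith
    have e2 : (1 - a) / (1 - 2 * a) ≤ (1 - b) / (1 - 2 * b) := by
      rw [div_le_div_iff₀ h1 h2]; nlinarith
    have p1 : 0 < a / (1 - 2 * a) := div_pos ha h1
    have p2 : 0 < (1 - a) / (1 - 2 * a) := div_pos (by linarith) h1
    have e3 : ((1 - a) / (1 - 2 * a)) ^ (d - 1) ≤ ((1 - b) / (1 - 2 * b)) ^ (d - 1) :=
      pow_le_pow_left₀ p2.le e2 _
    exact mul_lt_mul e1 e3 (pow_pos p2 _) (p1.trans e1).le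
  set b : ℝ := lam / (1 + 2 * lam) with hb
  have hb0 : 0 < b := by positivity
  have hb1 : 1 - 2 * b = 1 / (1 + 2 * lam) := by
    rw [hb]; field_simp; ring
  have hb2 : 0 < 1 - 2 * b := by rw [hb1]; positivity
  have hfb : lam ≤ fugacity d b := by
    have h1 : b / (1 - 2 * b) = lam := by
      rw [hb1, hb]; field_simp
    have h2 : 1 ≤ (1 - b) / (1 - 2 * b) := by
      rw [le_div_iff₀ hb2]; linarith
    have h3 := one_le_pow₀ (n := d - 1) h2
    unfold fugacity
    rw [h1]; nlinarith
  have hcont : ContinuousOn (fugacity d) (Set.Icc 0 b) := by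
    unfold fugacity
    have hne : ∀ x ∈ Set.Icc (0 : ℝ) b, 1 - 2 * x ≠ 0 := by
      intro x hx
      have := hx.2
      have : 0 < 1 - 2 * x := by linarith
      exact this.ne'
    have hd : ContinuousOn (fun x : ℝ => 1 - 2 * x) (Set.Icc 0 b) := by fun_prop
    exact (continuousOn_id.div hd hne).mul
      (((continuousOn_const.sub continuousOn_id).div hd hne).pow _)
  have h0 : fugacity d 0 = 0 := by simp [fugacity]
  obtain ⟨a, ha, hfa⟩ : lam ∈ fugacity d '' Set.Icc 0 b :=
    intermediate_value_Icc hb0.le hcont ⟨by rw [h0]; exact hlam.le, hfb⟩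
  have ha0 : 0 < a := by
    rcases ha.1.lt_or_eq with h | h
    · exact h
    · rw [← h, h0] at hfa
      exact absurd hfa hlam.ne
  refine ⟨a, ⟨ha0, by linarith [ha.2], hfa⟩, ?_⟩
  rintro c ⟨hc0, hc1, hc2⟩
  rcases lt_trichotomy c a with h | h | h
  · have := hmono c a hc0 h (by linarith [ha.2])
    linarith
  · exact h
  · have := hmono a c ha0 h hc1
    linarith

/-- The density `α(λ, d)`: the unique `α` in `(0, 1/2)` with `fugacity d α = λ`
(and `0` when `λ ≤ 0`). -/
def density (d : ℕ) (lam : ℝ) : ℝ :=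
  if h : 0 < lam then (existsUnique_density d h).choose else 0

/-! ### The rooted `d`-regular tree and the Markov model on it -/

/-- The vertices of the rooted `d`-regular tree. `none` is the root, which has the `d` children
`some (i, [])`; every other vertex `some (i, w)` has the `d - 1` children `some (i, j :: w)`. -/
abbrev TreeVertex (d : ℕ) : Type := Option (Fin d × List (Fin (d - 1)))

/-- The distance of a vertex from the root. -/
def depth {d : ℕ} : TreeVertex d → ℕ
  | none => 0
  | some (_, w) => w.length + 1

/-- Spin configurations; `true` is occupied (spin `1`), `false` is unoccupied (spin `0`). -/
abbrev Config (d : ℕ) : Type := TreeVertex d → Bool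

/-- The probability that a vertex is occupied given the spin of its parent:
`p₁₁ = 0` and `p₀₁ = α / (1 - α)`. -/
def occProb (α : ℝ) : Bool → ℝ
  | true => 0
  | false => α / (1 - α)

/-- The spin of the non-root vertex `some (i, w)`, generated from the spin of its parent and the
uniform variable at `some (i, w)`; `s` is the spin of the root. -/
def branchSpin {d : ℕ} (α : ℝ) (U : TreeVertex d → unitInterval) (s : Bool) (i : Fin d) :
    List (Fin (d - 1)) → Bool
  | [] => decide ((U (some (i, [])) : ℝ) < occProb α s)
  | j :: w => decide ((U (some (i, j :: w)) : ℝ) < occProb α (branchSpin α U s i w))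

/-- The configuration generated by the Markov model from variables `U v`: the root is occupied if
`U root < α`, and any other vertex `v` is occupied if `U v` is less than the probability of being
occupied given the spin of its parent. -/
def treeSpin {d : ℕ} (α : ℝ) (U : TreeVertex d → unitInterval) : Config d
  | none => decide ((U none : ℝ) < α)
  | some (i, w) => branchSpin α U (decide ((U none : ℝ) < α)) i w

/-- The law `P_{T_d}` of the Markov model with density `α` on the `d`-regular tree, generated from
independent uniform variables. -/
def treeMeasure (d : ℕ) (α : ℝ) : Measure (Config d) :=
  (Measure.infinitePi (fun _ : TreeVertex d => (volume : Measure unitInterval))).map (treeSpin α)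

theorem measurable_decide_lt {Ω : Type*} [MeasurableSpace Ω] {f g : Ω → ℝ}
    (hf : Measurable f) (hg : Measurable g) : Measurable (fun x => decide (f x < g x)) := by
  apply measurable_to_bool
  have : (fun x => decide (f x < g x)) ⁻¹' {true} = {x | f x < g x} := by
    ext x; simp
  rw [this]
  exact measurableSet_lt hf hg

theorem measurable_treeSpin {d : ℕ} (α : ℝ) : Measurable (treeSpin (d := d) α) := by
  have hocc : Measurable (occProb α) := measurable_of_finite _
  have hU : ∀ v : TreeVertex d, Measurable (fun U : TreeVertex d → unitInterval => (U v : ℝ)) :=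
    fun v => measurable_subtype_coe.comp (measurable_pi_apply v)
  have hroot := measurable_decide_lt (hU none) (measurable_const (a := α))
  refine measurable_pi_lambda _ fun v => ?_
  rcases v with _ | ⟨i, w⟩
  · exact hroot
  · simp only [treeSpin]
    induction w with
    | nil => exact measurable_decide_lt (hU _) (hocc.comp hroot)
    | cons j w ih => exact measurable_decide_lt (hU _) (hocc.comp ih)

instance isProbabilityMeasure_treeMeasure (d : ℕ) (α : ℝ) :
    IsProbabilityMeasure (treeMeasure d α) :=
  Measure.isProbabilityMeasure_map (measurable_treeSpin α).aemeasurable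

/-! ### Reconstruction -/

/-- The σ-algebra generated by `σ(L)`, the spins of the vertices at distance `L` from the root. -/
abbrev levelSigma (d L : ℕ) : MeasurableSpace (Config d) :=
  MeasurableSpace.comap (fun (σ : Config d) (v : {v : TreeVertex d // depth v = L}) => σ v)
    inferInstance

theorem levelSigma_le (d L : ℕ) : levelSigma d L ≤ MeasurableSpace.pi :=
  Measurable.comap_le (measurable_pi_lambda _ fun v => measurable_pi_apply v.1)

/-- The conditional probability `P_{T_d}(σ_ρ = 1 | σ(L))`, as a random variable. -/
def rootPosterior (d : ℕ) (α : ℝ) (L : ℕ) : Config d → ℝ :=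
  (treeMeasure d α)[Set.indicator {σ : Config d | σ none = true} (fun _ => (1 : ℝ)) |
    levelSigma d L]

/-- Non-reconstruction at fugacity `λ`: `P_{T_d}(σ_ρ = 1 | σ(L)) → α(λ, d)` in probability as
`L → ∞`. -/
def NonReconstruction (d : ℕ) (lam : ℝ) : Prop :=
  TendstoInMeasure (treeMeasure d (density d lam)) (rootPosterior d (density d lam)) atTop
    (fun _ => density d lam)

/-- Reconstruction at fugacity `λ`. -/
def Reconstruction (d : ℕ) (lam : ℝ) : Prop := ¬ NonReconstruction d lam

/-- `l` is a critical fugacity: non-reconstruction holds at all positive fugacities below `l`, and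
reconstruction holds at all fugacities above `l`. -/
def IsCriticalFugacity (d : ℕ) (l : ℝ) : Prop :=
  0 < l ∧ (∀ lam, 0 < lam → lam < l → NonReconstruction d lam) ∧
    ∀ lam, l < lam → Reconstruction d lam

/-- The reconstruction threshold `λ_R` of the hardcore model on the `d`-regular tree. -/
def lambdaR (d : ℕ) : ℝ := sSup {lam : ℝ | 0 < lam ∧ NonReconstruction d lam}

/-- The critical density `α_R`, that is, the density at fugacity `λ_R`. -/
def alphaR (d : ℕ) : ℝ := density d (lambdaR d)

/-- `IsCriticalFugacity` determines its argument, which is then `lambdaR d`. -/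
theorem IsCriticalFugacity.eq_lambdaR {d : ℕ} {l : ℝ} (h : IsCriticalFugacity d l) :
    l = lambdaR d := by
  have hne : {lam : ℝ | 0 < lam ∧ NonReconstruction d lam}.Nonempty :=
    ⟨l / 2, half_pos h.1, h.2.1 _ (half_pos h.1) (half_lt_self h.1)⟩
  have hlub : IsLUB {lam : ℝ | 0 < lam ∧ NonReconstruction d lam} l := by
    refine ⟨?_, ?_⟩
    · rintro x ⟨_, hx⟩
      by_contra hlx
      exact h.2.2 x (not_le.mp hlx) hx
    · intro u hu
      refine le_of_forall_lt fun c hc => ?_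
      have hm : max c 0 < l := max_lt hc h.1
      have h1 : 0 < (max c 0 + l) / 2 := by
        have := le_max_right c 0
        linarith [h.1]
      have h2 : (max c 0 + l) / 2 ≤ u := hu ⟨h1, h.2.1 _ h1 (by linarith)⟩
      have := le_max_left c 0
      linarith
  exact (hlub.csSup_eq hne).symm

end Hardcore

end

noncomputable section

namespace Hardcore

/-! ### Finite weights of the broadcast process -/

/-! Given the spins of level `n + 1`, the posterior of the root is an explicit Bayes ratio, and its
`L¹` distance from `α` is `α (1 - α)` times `rootGap`, the `ℓ¹` distance between the laws of the
level under the two root spins. Posteriors are bounded, so non-reconstruction is equivalent to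
`rootGap → 0` (`tendstoInMeasure_rootPosterior_iff`). Everything else concerns the finite sums
`leafWeight` and `levelWeight`, with `p = α / (1 - α)`.

Existence of the threshold: the observation for a smaller `p` is a randomized function of that for a
larger `p`, so `rootGap` increases with `p` (`rootGap_mono`) and hence with the fugacity. One
density without reconstruction and one with it then trap the threshold (`critical_of_bounds`). Write
`L = log d` and take densities `(L + log L + c) / d`; their fugacity is asymptotically `exp c * L ^
2` (`tendsto_fugacity_div`).

Upper bound, `c = 1 + ε`: declare a vertex occupied when all its children are declared unoccupied.
Error rates of order `1 / L` at occupied vertices and `1 / (d L)` at unoccupied ones reproduce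
themselves as soon as `c > 1`.

Lower bound, `c = -log log L - log 2 + log log 2`: let `z n` be the mean posterior of an occupied
vertex. Independence of the children and Jensen's inequality give `z (n + 1) ≤ p m / (1 - p + p m)`
with `m ≤ exp (κ (z n - p))`, where `κ = growthRate` is close to `L + log L + c`
(`posteriorMean_leafWeight_succ_le`). Starting from `z ≤ 1` this does not reach `p`. At two levels,
however, an occupied vertex has with probability at least about `2.4 log L / L` a child whose own
children are all unoccupied, and then its posterior is at most `1 / 2` (`posteriorMean_two_le`). The
resulting gain `1.2 log L / L` outweighs the `log L` in `κ`; three more steps of the recursion bring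
`z` into the range where it contracts to `p`, and Cauchy-Schwarz turns `z → p` into `rootGap → 0`.
-/

/-- The spins of the vertices `n` levels below a vertex, each vertex having `k` children. -/
def Leaf (k : ℕ) : ℕ → Type
  | 0 => Bool
  | n + 1 => Fin k → Leaf k n

instance instFintypeLeaf (k : ℕ) : (n : ℕ) → Fintype (Leaf k n)
  | 0 => inferInstanceAs (Fintype Bool)
  | n + 1 =>
    haveI := instFintypeLeaf k n
    haveI : DecidableEq (Fin k) := inferInstance
    inferInstanceAs (Fintype (Fin k → Leaf k n))

instance instDecidableEqLeaf (k n : ℕ) : DecidableEq (Leaf k n) := Classical.decEq _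

/-- `w s` is a probability vector for both values of `s`. -/
structure IsLaw {X : Type*} [Fintype X] (w : Bool → X → ℝ) : Prop where
  nonneg : ∀ s x, 0 ≤ w s x
  sum_eq_one : ∀ s, ∑ x, w s x = 1

/-- The law of the observation below a child, given the spin of its parent, where `w` is the law
given the spin of the child itself. -/
def childWeight {X : Type*} (p : ℝ) (w : Bool → X → ℝ) : Bool → X → ℝ
  | true => w false
  | false => fun x => (1 - p) * w false x + p * w true x

/-- The joint law of the observations below `m` children, given the spin of their parent. -/
def broadcast {X : Type*} (p : ℝ) (m : ℕ) (w : Bool → X → ℝ) (s : Bool) (A : Fin m → X) : ℝ :=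
  ∏ i, childWeight p w s (A i)

/-- The law of the spins `n` levels below a vertex with the given spin. -/
def leafWeight (k : ℕ) (p : ℝ) : (n : ℕ) → Bool → Leaf k n → ℝ
  | 0 => fun s (a : Bool) => if a = s then 1 else 0
  | n + 1 => broadcast p k (leafWeight k p n)

/-- The law of the spins at distance `n + 1` from the root, given the spin of the root. -/
def levelWeight (d : ℕ) (p : ℝ) (n : ℕ) : Bool → (Fin d → Leaf (d - 1) n) → ℝ :=
  broadcast p d (leafWeight (d - 1) p n)

theorem sum_pi_prod {X : Type*} [Fintype X] (m : ℕ) (f : Fin m → X → ℝ) :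
    ∑ A : Fin m → X, ∏ i, f i (A i) = ∏ i, ∑ x, f i x := by
  rw [Finset.prod_univ_sum, Fintype.piFinset_univ]

theorem sum_pi_prod_const {X : Type*} [Fintype X] (m : ℕ) (f : X → ℝ) :
    ∑ A : Fin m → X, ∏ i, f (A i) = (∑ x, f x) ^ m := by
  rw [sum_pi_prod m fun _ => f]; simp

section Law

variable {X : Type*} [Fintype X] {p : ℝ} {w : Bool → X → ℝ}

theorem IsLaw.child (hw : IsLaw w) (h0 : 0 ≤ p) (h1 : p ≤ 1) : IsLaw (childWeight p w) where
  nonneg s x := by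
    cases s
    · exact add_nonneg (mul_nonneg (by linarith) (hw.nonneg _ _)) (mul_nonneg h0 (hw.nonneg _ _))
    · exact hw.nonneg _ _
  sum_eq_one s := by
    cases s
    · simp [childWeight, Finset.sum_add_distrib, ← Finset.mul_sum, hw.sum_eq_one]
    · exact hw.sum_eq_one _

theorem IsLaw.broadcast (hw : IsLaw w) (h0 : 0 ≤ p) (h1 : p ≤ 1) (m : ℕ) :
    IsLaw (broadcast p m w) where
  nonneg s A := Finset.prod_nonneg fun i _ => (hw.child h0 h1).nonneg s (A i)
  sum_eq_one s := by
    simp only [Hardcore.broadcast]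
    rw [sum_pi_prod_const, (hw.child h0 h1).sum_eq_one, one_pow]

end Law

theorem isLaw_leafWeight (k : ℕ) {p : ℝ} (h0 : 0 ≤ p) (h1 : p ≤ 1) (n : ℕ) :
    IsLaw (leafWeight k p n) := by
  induction n with
  | zero =>
    refine ⟨fun s x => ?_, fun s => ?_⟩
    · simp only [leafWeight]; split_ifs <;> norm_num
    · exact (Fintype.sum_eq_single (α := Bool) s fun x hx => if_neg hx).trans (if_pos rfl)
  | succ n ih => exact ih.broadcast h0 h1 k

theorem isLaw_levelWeight (d : ℕ) {p : ℝ} (h0 : 0 ≤ p) (h1 : p ≤ 1) (n : ℕ) :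
    IsLaw (levelWeight d p n) :=
  (isLaw_leafWeight (d - 1) h0 h1 n).broadcast h0 h1 d

/-- The `ℓ¹` distance of the laws of level `n + 1` given the two spins of the root. -/
def rootGap (d : ℕ) (p : ℝ) (n : ℕ) : ℝ :=
  ∑ A, |levelWeight d p n true A - levelWeight d p n false A|

theorem rootGap_nonneg (d : ℕ) (p : ℝ) (n : ℕ) : 0 ≤ rootGap d p n :=
  Finset.sum_nonneg fun _ _ => abs_nonneg _

/-! ### Degradation and monotonicity -/

/-- `K` is a stochastic matrix that turns the laws `w s` into the laws `w' s`. -/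
structure IsDegradation {X Y : Type*} [Fintype X] [Fintype Y] (w : Bool → X → ℝ)
    (w' : Bool → Y → ℝ) (K : X → Y → ℝ) : Prop where
  nonneg : ∀ x y, 0 ≤ K x y
  sum_eq_one : ∀ x, ∑ y, K x y = 1
  map : ∀ s y, ∑ x, w s x * K x y = w' s y

/-- Data processing: a stochastic matrix contracts the `ℓ¹` norm. -/
theorem IsDegradation.sum_abs_le {X Y : Type*} [Fintype X] [Fintype Y] {w : Bool → X → ℝ}
    {w' : Bool → Y → ℝ} {K : X → Y → ℝ} (h : IsDegradation w w' K) :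
    ∑ y, |w' true y - w' false y| ≤ ∑ x, |w true x - w false x| := by
  calc ∑ y, |w' true y - w' false y|
      = ∑ y, |∑ x, (w true x - w false x) * K x y| := by
        refine Finset.sum_congr rfl fun y _ => ?_
        rw [← h.map, ← h.map, ← Finset.sum_sub_distrib]
        simp [sub_mul]
    _ ≤ ∑ y, ∑ x, |w true x - w false x| * K x y := by
        refine Finset.sum_le_sum fun y _ => (Finset.abs_sum_le_sum_abs _ _).trans_eq ?_
        exact Finset.sum_congr rfl fun x _ => by rw [abs_mul, abs_of_nonneg (h.nonneg x y)]
    _ = ∑ x, |w true x - w false x| := by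
        rw [Finset.sum_comm]
        refine Finset.sum_congr rfl fun x _ => ?_
        rw [← Finset.mul_sum, h.sum_eq_one, mul_one]

/-- Thinning lowers `p`: independently for each child, degrade its observation with probability `q =
p' / p`, and otherwise replace it by a fresh sample from the unoccupied law. An occupied child then
looks occupied with probability `q` only, while an unoccupied one keeps its law. -/
theorem IsDegradation.broadcast {X Y : Type*} [Fintype X] [Fintype Y] {w : Bool → X → ℝ}
    {w' : Bool → Y → ℝ} {K : X → Y → ℝ} (h : IsDegradation w w' K) (hw : IsLaw w)
    (hw' : IsLaw w') {p p' : ℝ} (h0 : 0 ≤ p') (hle : p' ≤ p) (hp : 0 < p) (m : ℕ) :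
    ∃ K', IsDegradation (broadcast p m w) (broadcast p' m w') K' := by
  set q := p' / p with hq
  have hq0 : 0 ≤ q := by positivity
  have hq1 : q ≤ 1 := by rw [hq, div_le_one hp]; exact hle
  have hpq : q * p = p' := by rw [hq]; field_simp
  set K₁ : X → Y → ℝ := fun x y => q * K x y + (1 - q) * w' false y with hK₁
  have h1 : ∀ s y, ∑ x, childWeight p w s x * K₁ x y = childWeight p' w' s y := by
    intro s y
    have e : ∀ t, ∑ x, w t x * K₁ x y = q * w' t y + (1 - q) * w' false y := by
      intro t
      calc ∑ x, w t x * K₁ x y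
          = q * ∑ x, w t x * K x y + (1 - q) * w' false y * ∑ x, w t x := by
            rw [Finset.mul_sum, Finset.mul_sum, ← Finset.sum_add_distrib]
            exact Finset.sum_congr rfl fun x _ => by rw [hK₁]; ring
        _ = _ := by rw [h.map, hw.sum_eq_one, mul_one]
    cases s
    · calc ∑ x, childWeight p w false x * K₁ x y
          = (1 - p) * ∑ x, w false x * K₁ x y + p * ∑ x, w true x * K₁ x y := by
            rw [Finset.mul_sum, Finset.mul_sum, ← Finset.sum_add_distrib]
            exact Finset.sum_congr rfl fun x _ => by simp only [childWeight]; ring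
        _ = _ := by
            rw [e, e]; simp only [childWeight]; rw [← hpq]; ring
    · simp only [childWeight]; rw [e]; ring
  refine ⟨fun A B => ∏ i, K₁ (A i) (B i), fun A B => ?_, fun A => ?_, fun s B => ?_⟩
  · refine Finset.prod_nonneg fun i _ => ?_
    exact add_nonneg (mul_nonneg hq0 (h.nonneg _ _))
      (mul_nonneg (by linarith) (hw'.nonneg _ _))
  · rw [sum_pi_prod m fun i => K₁ (A i)]
    refine Finset.prod_eq_one fun i _ => ?_
    simp [hK₁, Finset.sum_add_distrib, ← Finset.mul_sum, h.sum_eq_one, hw'.sum_eq_one]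
  · simp only [Hardcore.broadcast, ← Finset.prod_mul_distrib]
    rw [sum_pi_prod m fun i x => childWeight p w s x * K₁ x (B i)]
    exact Finset.prod_congr rfl fun i _ => h1 s (B i)

theorem exists_degradation_leafWeight (k : ℕ) {p p' : ℝ} (h0 : 0 ≤ p') (hle : p' ≤ p)
    (hp : 0 < p) (hp1 : p ≤ 1) (n : ℕ) :
    ∃ K, IsDegradation (leafWeight k p n) (leafWeight k p' n) K := by
  induction n with
  | zero =>
    refine ⟨fun x y => if x = y then 1 else 0, fun x y => ?_, fun x => ?_, fun s y => ?_⟩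
    · split_ifs <;> norm_num
    · simp
    · simp [leafWeight]
  | succ n ih =>
    obtain ⟨K, hK⟩ := ih
    exact hK.broadcast (isLaw_leafWeight k hp.le hp1 n)
      (isLaw_leafWeight k h0 (hle.trans hp1) n) h0 hle hp k

theorem rootGap_mono (d : ℕ) {p p' : ℝ} (h0 : 0 ≤ p') (hle : p' ≤ p) (hp : 0 < p) (hp1 : p ≤ 1)
    (n : ℕ) : rootGap d p' n ≤ rootGap d p n := by
  obtain ⟨K, hK⟩ := exists_degradation_leafWeight (d - 1) h0 hle hp hp1 n
  obtain ⟨K', hK'⟩ := hK.broadcast (isLaw_leafWeight (d - 1) hp.le hp1 n)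
    (isLaw_leafWeight (d - 1) h0 (hle.trans hp1) n) h0 hle hp d
  exact hK'.sum_abs_le

/-! ### A recursive estimator -/

/-- The recursive estimator of the spin of a vertex: it is estimated to be occupied when all of
its children are estimated to be unoccupied. -/
def estimator (k : ℕ) : (n : ℕ) → Leaf k n → Bool
  | 0 => fun (a : Bool) => a
  | n + 1 => fun (A : Fin k → Leaf k n) => decide (∀ i, estimator k n (A i) = false)

/-- The total weight of the observations `x` with `e x = b`. -/
def mass {X : Type*} [Fintype X] (f : X → ℝ) (e : X → Bool) (b : Bool) : ℝ :=
  ∑ x, if e x = b then f x else 0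

theorem mass_add {X : Type*} [Fintype X] (f : X → ℝ) (e : X → Bool) :
    mass f e true + mass f e false = ∑ x, f x := by
  rw [mass, mass, ← Finset.sum_add_distrib]
  refine Finset.sum_congr rfl fun x _ => ?_
  cases e x <;> simp

theorem mass_nonneg {X : Type*} [Fintype X] {f : X → ℝ} (hf : ∀ x, 0 ≤ f x) (e : X → Bool)
    (b : Bool) : 0 ≤ mass f e b :=
  Finset.sum_nonneg fun x _ => by split_ifs; exacts [hf x, le_rfl]

theorem mass_childWeight_false {X : Type*} [Fintype X] (p : ℝ) (w : Bool → X → ℝ) (e : X → Bool)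
    (b : Bool) : mass (childWeight p w false) e b
      = (1 - p) * mass (w false) e b + p * mass (w true) e b := by
  simp only [mass, Finset.mul_sum, ← Finset.sum_add_distrib]
  refine Finset.sum_congr rfl fun x _ => ?_
  split_ifs <;> simp [childWeight]

theorem mass_broadcast {X : Type*} [Fintype X] (p : ℝ) (m : ℕ) (w : Bool → X → ℝ) (e : X → Bool)
    (s : Bool) :
    mass (broadcast p m w s) (fun A => decide (∀ i, e (A i) = false)) true
      = mass (childWeight p w s) e false ^ m := by
  simp only [mass]
  rw [← sum_pi_prod_const]
  refine Finset.sum_congr rfl fun A _ => ?_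
  simp only [decide_eq_true_eq]
  split_ifs with h
  · exact Finset.prod_congr rfl fun i _ => by rw [if_pos (h i)]
  · push Not at h
    obtain ⟨i, hi⟩ := h
    exact (Finset.prod_eq_zero (Finset.mem_univ i) (if_neg hi)).symm

/-- An occupied vertex is misjudged only if one of its children, all unoccupied, is declared
occupied: a union bound, here in Bernoulli form. An unoccupied vertex is misjudged only if every
child is declared unoccupied, which for a single child has probability at most `1 - p + p * ε`. -/
theorem mass_broadcast_bounds {X : Type*} [Fintype X] {p : ℝ} {w : Bool → X → ℝ} (hw : IsLaw w)
    (h0 : 0 ≤ p) (h1 : p ≤ 1) (e : X → Bool) {ε δ : ℝ} (hδ : δ ≤ 1)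
    (hε : mass (w true) e false ≤ ε) (hδ' : mass (w false) e true ≤ δ) (m : ℕ) :
    mass (broadcast p m w true) (fun A => decide (∀ i, e (A i) = false)) false ≤ m * δ ∧
    mass (broadcast p m w false) (fun A => decide (∀ i, e (A i) = false)) true
      ≤ (1 - p * (1 - ε)) ^ m := by
  have ht := mass_add (w true) e
  have hf := mass_add (w false) e
  rw [hw.sum_eq_one] at ht hf
  have n1 := mass_nonneg (hw.nonneg false) e true
  have n2 := mass_nonneg (hw.nonneg false) e false
  have n3 := mass_nonneg (hw.nonneg true) e false
  constructor
  · have hb := mass_add (broadcast p m w true) (fun A => decide (∀ i, e (A i) = false))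
    rw [(hw.broadcast h0 h1 m).sum_eq_one, mass_broadcast] at hb
    simp only [childWeight] at hb
    have h2 : (1 - δ) ^ m ≤ mass (w false) e false ^ m :=
      pow_le_pow_left₀ (by linarith) (by linarith) m
    have h3 : 1 + (m : ℝ) * (-δ) ≤ (1 + -δ) ^ m := one_add_mul_le_pow (by linarith) m
    rw [← sub_eq_add_neg] at h3
    linarith
  · rw [mass_broadcast, mass_childWeight_false]
    refine pow_le_pow_left₀ ?_ ?_ m
    · exact add_nonneg (mul_nonneg (by linarith) n2) (mul_nonneg h0 n3)
    · have h4 : (1 - p) * mass (w false) e false ≤ (1 - p) * 1 :=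
        mul_le_mul_of_nonneg_left (by linarith) (by linarith)
      have h5 : p * mass (w true) e false ≤ p * ε := mul_le_mul_of_nonneg_left hε h0
      linarith

/-- The hypotheses `hk` and `hstep` say that the pair `(ε, δ)` is preserved by one level of the
recursion; at level 0 the spin itself is seen and there is no error. -/
theorem estimator_bounds (k : ℕ) {p ε δ : ℝ} (h0 : 0 ≤ p) (h1 : p ≤ 1) (hε : 0 ≤ ε)
    (hδ : 0 ≤ δ) (hδ1 : δ ≤ 1) (hk : k * δ ≤ ε) (hstep : (1 - p * (1 - ε)) ^ k ≤ δ) (n : ℕ) :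
    mass (leafWeight k p n true) (estimator k n) false ≤ ε ∧
    mass (leafWeight k p n false) (estimator k n) true ≤ δ := by
  induction n with
  | zero =>
    constructor
    · refine (Finset.sum_nonpos fun (x : Bool) _ => ?_).trans hε
      cases x <;> simp [leafWeight, estimator]
    · refine (Finset.sum_nonpos fun (x : Bool) _ => ?_).trans hδ
      cases x <;> simp [leafWeight, estimator]
  | succ n ih =>
    have := mass_broadcast_bounds (isLaw_leafWeight k h0 h1 n) h0 h1 (estimator k n) hδ1
      ih.1 ih.2 k
    exact ⟨this.1.trans hk, this.2.trans hstep⟩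

theorem rootGap_lower_bound (d : ℕ) {p ε δ : ℝ} (h0 : 0 ≤ p) (h1 : p ≤ 1) (hε : 0 ≤ ε)
    (hδ : 0 ≤ δ) (hδ1 : δ ≤ 1) (hk : (d - 1 : ℕ) * δ ≤ ε)
    (hstep : (1 - p * (1 - ε)) ^ (d - 1) ≤ δ) (n : ℕ) :
    1 - d * δ - (1 - p * (1 - ε)) ^ d ≤ rootGap d p n := by
  obtain ⟨hb1, hb2⟩ := estimator_bounds (d - 1) h0 h1 hε hδ hδ1 hk hstep n
  have hl := isLaw_levelWeight d h0 h1 n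
  obtain ⟨h2, h3⟩ := mass_broadcast_bounds (isLaw_leafWeight (d - 1) h0 h1 n) h0 h1
    (estimator (d - 1) n) hδ1 hb1 hb2 d
  have h4 := mass_add (levelWeight d p n true)
    (fun A => decide (∀ i, estimator (d - 1) n (A i) = false))
  rw [hl.sum_eq_one] at h4
  -- The event that the root is declared occupied serves as a test event; its two probabilities
  -- differ by at most the `ℓ¹` distance.
  have h5 : mass (levelWeight d p n true)
        (fun A => decide (∀ i, estimator (d - 1) n (A i) = false)) true
      - mass (levelWeight d p n false)
        (fun A => decide (∀ i, estimator (d - 1) n (A i) = false)) true ≤ rootGap d p n := by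
    simp only [mass, rootGap, ← Finset.sum_sub_distrib]
    refine Finset.sum_le_sum fun A _ => ?_
    split_ifs
    · exact le_abs_self _
    · simp
  simp only [levelWeight] at h4 h5
  linarith

/-! ### Decay of the magnetization -/

/-- The mean, given that a vertex is occupied, of its posterior probability of being occupied
when its prior probability is `p`. -/
def posteriorMean {X : Type*} [Fintype X] (p : ℝ) (w : Bool → X → ℝ) : ℝ :=
  ∑ x, p * (w true x ^ 2 / childWeight p w false x)

/-- The second moment of the likelihood ratio. -/
def ratioMoment {X : Type*} [Fintype X] (w : Bool → X → ℝ) : ℝ :=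
  ∑ x, w true x ^ 2 / w false x

section Moment

variable {X : Type*} [Fintype X] {p : ℝ} {w : Bool → X → ℝ}

/-- The children are independent given the parent, so the moment factorizes. A child of an occupied
parent has law `w false`; solving the mixture `childWeight p w false` for `w false` expresses the
one-child moment through `posteriorMean`. -/
theorem ratioMoment_broadcast (hw : IsLaw w) (h1 : p < 1)
    (hpos : ∀ x, 0 < childWeight p w false x) (m : ℕ) :
    ratioMoment (broadcast p m w) = (1 + p * (posteriorMean p w - p) / (1 - p) ^ 2) ^ m := by
  have hp : 1 - p ≠ 0 := by linarith
  have key : ∑ x, w false x ^ 2 / childWeight p w false x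
      = 1 + p * (posteriorMean p w - p) / (1 - p) ^ 2 := by
    calc ∑ x, w false x ^ 2 / childWeight p w false x
        = ∑ x, ((1 - p) ^ 2)⁻¹ * (childWeight p w false x - 2 * p * w true x
            + p * (p * (w true x ^ 2 / childWeight p w false x))) := by
          refine Finset.sum_congr rfl fun x _ => ?_
          have hc := (hpos x).ne'
          have e : w false x = (childWeight p w false x - p * w true x) / (1 - p) := by
            simp only [childWeight]; field_simp; ring
          rw [e]
          field_simp
          ring
      _ = ((1 - p) ^ 2)⁻¹ * (1 - 2 * p + p * posteriorMean p w) := by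
          rw [← Finset.mul_sum, Finset.sum_add_distrib, Finset.sum_sub_distrib,
            ← Finset.mul_sum, ← Finset.mul_sum, hw.sum_eq_one]
          rw [mul_one]
          congr 3
          by_cases h : 0 ≤ p ∧ p ≤ 1
          · rw [(hw.child h.1 h.2).sum_eq_one]
          · simp [childWeight, Finset.sum_add_distrib, ← Finset.mul_sum, hw.sum_eq_one]
      _ = _ := by field_simp; ring
  rw [← key, ← sum_pi_prod_const, ratioMoment]
  refine Finset.sum_congr rfl fun A _ => ?_
  simp only [broadcast, ← Finset.prod_pow, ← Finset.prod_div_distrib]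
  rfl

/-- Cauchy-Schwarz: conditioning on the vertex being occupied can only raise its mean posterior
above the prior. -/
theorem le_posteriorMean (hw : IsLaw w) (h0 : 0 ≤ p) (h1 : p ≤ 1)
    (hpos : ∀ x, 0 < childWeight p w false x) : p ≤ posteriorMean p w := by
  have := Finset.sq_sum_div_le_sum_sq_div Finset.univ (w true)
    (g := childWeight p w false) fun x _ => hpos x
  rw [hw.sum_eq_one, (hw.child h0 h1).sum_eq_one] at this
  rw [posteriorMean, ← Finset.mul_sum]
  nlinarith

/-- Jensen's inequality under `w true` for the concave map `r ↦ r / (1 - p + p * r)` of the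
likelihood ratio `r = w true x / w false x`, whose mean is `ratioMoment w`. -/
theorem posteriorMean_le (hw : IsLaw w) (h0 : 0 ≤ p) (h1 : p < 1) (hpos : ∀ x, 0 < w false x) :
    posteriorMean p w ≤ p * (ratioMoment w / (1 - p + p * ratioMoment w)) := by
  set m := ratioMoment w with hm
  have hm0 : 0 ≤ m := Finset.sum_nonneg fun x _ => div_nonneg (sq_nonneg _) (hpos x).le
  set D := 1 - p + p * m with hD
  have hD0 : 0 < D := by have := mul_nonneg h0 hm0; linarith
  -- The tangent line of that concave map at `r = m`, multiplied by `w true x`.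
  have term : ∀ x, w true x ^ 2 / childWeight p w false x
      ≤ (p * m ^ 2 * w true x + (1 - p) * (w true x ^ 2 / w false x)) / D ^ 2 := by
    intro x
    have hx := hpos x
    have hy := hw.nonneg true x
    have hc : 0 < childWeight p w false x := by
      have := mul_nonneg h0 hy
      have := mul_pos (sub_pos.2 h1) hx
      simp only [childWeight]; linarith
    have e : p * m ^ 2 * w true x + (1 - p) * (w true x ^ 2 / w false x)
        = w true x * (p * m ^ 2 * w false x + (1 - p) * w true x) / w false x := by
      field_simp
    rw [e, div_div, div_le_div_iff₀ hc (by positivity)]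
    have h3 : 0 ≤ w true x * ((1 - p) * p * (m * w false x - w true x) ^ 2) :=
      mul_nonneg hy (mul_nonneg (mul_nonneg (by linarith) h0) (sq_nonneg _))
    have h4 : w true x * (p * m ^ 2 * w false x + (1 - p) * w true x) * childWeight p w false x
        - w true x ^ 2 * (w false x * D ^ 2)
        = w true x * ((1 - p) * p * (m * w false x - w true x) ^ 2) := by
      simp only [childWeight, hD]; ring
    linarith
  rw [posteriorMean, ← Finset.mul_sum]
  refine mul_le_mul_of_nonneg_left ((Finset.sum_le_sum fun x _ => term x).trans_eq ?_) h0
  rw [← Finset.sum_div, Finset.sum_add_distrib, ← Finset.mul_sum, ← Finset.mul_sum,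
    hw.sum_eq_one, ← ratioMoment, ← hm]
  field_simp
  rw [hD]; ring

/-- The `χ²` divergence dominates the squared `ℓ¹` distance, by Cauchy-Schwarz. -/
theorem sq_sum_abs_le (hw : IsLaw w) (hpos : ∀ x, 0 < w false x) :
    (∑ x, |w true x - w false x|) ^ 2 ≤ ratioMoment w - 1 := by
  have := Finset.sq_sum_div_le_sum_sq_div Finset.univ (fun x => |w true x - w false x|)
    (g := w false) fun x _ => hpos x
  rw [hw.sum_eq_one, div_one] at this
  refine this.trans_eq ?_
  calc ∑ x, |w true x - w false x| ^ 2 / w false x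
      = ∑ x, (w true x ^ 2 / w false x - 2 * w true x + w false x) := by
        refine Finset.sum_congr rfl fun x _ => ?_
        have := (hpos x).ne'
        rw [sq_abs]; field_simp; ring
    _ = _ := by
        rw [Finset.sum_add_distrib, Finset.sum_sub_distrib, ← Finset.mul_sum,
          hw.sum_eq_one, hw.sum_eq_one, ratioMoment]
        ring

end Moment

theorem broadcast_false_pos {X : Type*} {p : ℝ} {w : Bool → X → ℝ}
    (hpos : ∀ x, 0 < childWeight p w false x) (m : ℕ) (A : Fin m → X) :
    0 < broadcast p m w false A :=
  Finset.prod_pos fun i _ => hpos (A i)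

/-- At level 0 the law `leafWeight k p 0 false` is a point mass, so positivity must be stated for
the mixture; from level 1 on it also holds for the law given an unoccupied vertex. -/
theorem childWeight_leafWeight_pos (k : ℕ) {p : ℝ} (h0 : 0 < p) (h1 : p < 1) (n : ℕ)
    (x : Leaf k n) : 0 < childWeight p (leafWeight k p n) false x := by
  induction n with
  | zero =>
    change Bool at x
    cases x
    · simpa [childWeight, leafWeight] using h1
    · simpa [childWeight, leafWeight] using h0
  | succ n ih =>
    have hb : 0 < leafWeight k p (n + 1) false x := broadcast_false_pos ih k x
    have h2 := (isLaw_leafWeight k h0.le h1.le (n + 1)).nonneg true x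
    exact add_pos_of_pos_of_nonneg (mul_pos (by linarith) hb) (mul_nonneg h0.le h2)

/-- The exponent that governs the growth of `ratioMoment` over one level. -/
def growthRate (k : ℕ) (p : ℝ) : ℝ := k * p / (1 - p) ^ 2

/-! ### The recursion for the posterior mean -/

section Recursion

variable {k : ℕ} {p : ℝ}

theorem one_add_pow_le_exp {z : ℝ} (h0 : 0 ≤ p) (h1 : p < 1) (hz : p ≤ z) :
    (1 + p * (z - p) / (1 - p) ^ 2) ^ k ≤ exp (growthRate k p * (z - p)) := by
  have hp : 0 < 1 - p := by linarith
  have hy : 0 ≤ p * (z - p) / (1 - p) ^ 2 :=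
    div_nonneg (mul_nonneg h0 (by linarith)) (by positivity)
  calc (1 + p * (z - p) / (1 - p) ^ 2) ^ k ≤ exp (p * (z - p) / (1 - p) ^ 2) ^ k := by
        refine pow_le_pow_left₀ (by linarith) ?_ k
        linarith [add_one_le_exp (p * (z - p) / (1 - p) ^ 2)]
    _ = exp (growthRate k p * (z - p)) := by
        rw [← exp_nat_mul]; congr 1; simp only [growthRate]; ring

theorem le_posteriorMean_leafWeight (k : ℕ) (h0 : 0 < p) (h1 : p < 1) (n : ℕ) :
    p ≤ posteriorMean p (leafWeight k p n) :=
  le_posteriorMean (isLaw_leafWeight k h0.le h1.le n) h0.le h1.le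
    (childWeight_leafWeight_pos k h0 h1 n)

theorem posteriorMean_leafWeight_succ_le (h0 : 0 < p) (h1 : p < 1) (n : ℕ) :
    ∃ m, 1 ≤ m ∧ m ≤ exp (growthRate k p * (posteriorMean p (leafWeight k p n) - p)) ∧
      posteriorMean p (leafWeight k p (n + 1)) ≤ p * (m / (1 - p + p * m)) := by
  have hz := le_posteriorMean_leafWeight k h0 h1 n
  have hp : 0 < 1 - p := by linarith
  refine ⟨_, ?_, one_add_pow_le_exp h0.le h1 hz, ?_⟩
  · refine one_le_pow₀ ?_
    have : 0 ≤ p * (posteriorMean p (leafWeight k p n) - p) / (1 - p) ^ 2 :=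
      div_nonneg (mul_nonneg h0.le (by linarith)) (by positivity)
    linarith
  · rw [← ratioMoment_broadcast (isLaw_leafWeight k h0.le h1.le n) h1
      (childWeight_leafWeight_pos k h0 h1 n)]
    exact posteriorMean_le (isLaw_leafWeight k h0.le h1.le (n + 1)) h0.le h1
      (broadcast_false_pos (childWeight_leafWeight_pos k h0 h1 n) k)

theorem posteriorMean_succ_le_of_exp_le (h0 : 0 < p) (h1 : p < 1) (n : ℕ) {M : ℝ}
    (hM : exp (growthRate k p * posteriorMean p (leafWeight k p n)) ≤ M) :
    posteriorMean p (leafWeight k p (n + 1)) ≤ 1 - (1 - p) / (1 - p + p * M) := by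
  obtain ⟨m, hm1, hm2, hm3⟩ := posteriorMean_leafWeight_succ_le (k := k) h0 h1 n
  have hp : 0 < 1 - p := by linarith
  have hg : 0 ≤ growthRate k p := by unfold growthRate; positivity
  have hmM : m ≤ M := by
    refine hm2.trans (le_trans (exp_le_exp.2 ?_) hM)
    exact mul_le_mul_of_nonneg_left (by linarith) hg
  have hD : 0 < 1 - p + p * m := by nlinarith
  have hDM : 1 - p + p * m ≤ 1 - p + p * M := by nlinarith
  have e : p * (m / (1 - p + p * m)) = 1 - (1 - p) / (1 - p + p * m) := by
    field_simp; ring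
  rw [e] at hm3
  have := div_le_div_of_nonneg_left hp.le hD hDM
  linarith

/-- The form of the recursion for small `z - p`, obtained by dropping the denominator, which is at
least 1 since `m ≥ 1`. -/
theorem posteriorMean_succ_sub_le (h0 : 0 < p) (h1 : p < 1) (n : ℕ) :
    posteriorMean p (leafWeight k p (n + 1)) - p
      ≤ p * (exp (growthRate k p * (posteriorMean p (leafWeight k p n) - p)) - 1) := by
  obtain ⟨m, hm1, hm2, hm3⟩ := posteriorMean_leafWeight_succ_le (k := k) h0 h1 n
  have hD : 1 ≤ 1 - p + p * m := by nlinarith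
  have h2 : m / (1 - p + p * m) ≤ m := div_le_self (by linarith) hD
  nlinarith

/-- Once the exponent is at most 1, `exp t - 1 ≤ 2 * t` bounds the step by a factor `2 * p *
growthRate k p ≤ 1 / 2`, and the exponent stays at most 1, so the decay is geometric. -/
theorem tendsto_posteriorMean (h0 : 0 < p) (h1 : p < 1) (N : ℕ)
    (hN : growthRate k p * (posteriorMean p (leafWeight k p N) - p) ≤ 1)
    (hc : 4 * p * growthRate k p ≤ 1) :
    Tendsto (fun n => posteriorMean p (leafWeight k p n)) atTop (𝓝 p) := by
  have hp : 0 < 1 - p := by linarith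
  have hg : 0 ≤ growthRate k p := by unfold growthRate; positivity
  set y : ℕ → ℝ := fun n => posteriorMean p (leafWeight k p n) - p with hy
  have hy0 : ∀ n, 0 ≤ y n := fun n => sub_nonneg.2 (le_posteriorMean_leafWeight k h0 h1 n)
  have hstep : ∀ n, growthRate k p * y n ≤ 1 → y (n + 1) ≤ y n / 2 := by
    intro n hn
    have h2 := posteriorMean_succ_sub_le (k := k) h0 h1 n
    have h3 : 0 ≤ growthRate k p * y n := mul_nonneg hg (hy0 n)
    have h4 : exp (growthRate k p * y n) - 1 ≤ 2 * (growthRate k p * y n) := by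
      have := abs_exp_sub_one_le (x := growthRate k p * y n) (by rwa [abs_of_nonneg h3])
      rw [abs_of_nonneg h3] at this
      exact (le_abs_self _).trans this
    have h5 : y (n + 1) ≤ p * (2 * (growthRate k p * y n)) :=
      h2.trans (mul_le_mul_of_nonneg_left h4 h0.le)
    nlinarith [hy0 n]
  have hgeo : ∀ j, growthRate k p * y (N + j) ≤ 1 ∧ y (N + j) ≤ y N * (1 / 2) ^ j := by
    intro j
    induction j with
    | zero => exact ⟨hN, by simp⟩
    | succ j ih =>
      have h2 := hstep _ ih.1
      have h3 := hy0 (N + j)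
      refine ⟨?_, ?_⟩
      · refine le_trans ?_ ih.1
        exact mul_le_mul_of_nonneg_left (by rw [← add_assoc]; linarith) hg
      · rw [← add_assoc, pow_succ]; linarith [ih.2]
  have hlim : Tendsto (fun j => y (j + N)) atTop (𝓝 0) := by
    have h2 : Tendsto (fun j : ℕ => y N * (1 / 2 : ℝ) ^ j) atTop (𝓝 0) := by
      simpa using (tendsto_pow_atTop_nhds_zero_of_lt_one (by norm_num) (by norm_num :
        (1 / 2 : ℝ) < 1)).const_mul (y N)
    refine squeeze_zero (fun j => hy0 _) (fun j => ?_) h2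
    rw [add_comm]; exact (hgeo j).2
  have := ((tendsto_add_atTop_iff_nat N).1 hlim).add_const p
  simpa [hy] using this

theorem tendsto_rootGap {d : ℕ} (h0 : 0 < p) (h1 : p < 1)
    (h : Tendsto (fun n => posteriorMean p (leafWeight (d - 1) p n)) atTop (𝓝 p)) :
    Tendsto (rootGap d p) atTop (𝓝 0) := by
  have hp : 1 - p ≠ 0 := by linarith
  have hm : Tendsto (fun n => √((1 + p * (posteriorMean p (leafWeight (d - 1) p n) - p)
      / (1 - p) ^ 2) ^ d - 1)) atTop (𝓝 0) := by
    have h2 : Continuous fun z : ℝ => √((1 + p * (z - p) / (1 - p) ^ 2) ^ d - 1) := by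
      fun_prop
    have h3 := (h2.tendsto p).comp h
    simpa [Function.comp_def] using h3
  refine squeeze_zero (fun n => rootGap_nonneg d p n) (fun n => ?_) hm
  refine Real.le_sqrt_of_sq_le ?_
  rw [← ratioMoment_broadcast (isLaw_leafWeight (d - 1) h0.le h1.le n) h1
      (childWeight_leafWeight_pos (d - 1) h0 h1 n)]
  exact sq_sum_abs_le (isLaw_levelWeight d h0.le h1.le n)
    (broadcast_false_pos (childWeight_leafWeight_pos (d - 1) h0 h1 n) d)

theorem leafWeight_one_zero (k : ℕ) (p : ℝ) :
    leafWeight k p 1 true (fun _ => false) = 1 ∧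
    leafWeight k p 1 false (fun _ => false) = (1 - p) ^ k := by
  constructor
  · change ∏ i : Fin k, childWeight p (leafWeight k p 0) true ((fun _ => false : Fin k → Bool) i) = 1
    exact Finset.prod_eq_one fun i _ => by simp [childWeight, leafWeight]
  · calc ∏ i : Fin k, childWeight p (leafWeight k p 0) false ((fun _ => false : Fin k → Bool) i)
        = ∏ _i : Fin k, (1 - p) :=
          Finset.prod_congr rfl fun i _ => by simp [childWeight, leafWeight]
      _ = (1 - p) ^ k := by simp

/-- Call a child clear if all its own children are seen unoccupied. A clear child is plausibly
occupied, which speaks against an occupied parent: in that case the posterior is at most `1 / 2`.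
Given an occupied vertex, no child is clear with probability `(1 - (1 - p) ^ k) ^ k`, and there the
posterior is bounded by 1. -/
theorem posteriorMean_two_le (h0 : 0 < p) (h1 : p < 1) :
    posteriorMean p (leafWeight k p 2) ≤ (1 + (1 - (1 - p) ^ k) ^ k) / 2 := by
  set a₀ : Leaf k 1 := fun _ => false with ha₀
  set w := leafWeight k p 1 with hw
  have hl : IsLaw w := isLaw_leafWeight k h0.le h1.le 1
  obtain ⟨ht, hf⟩ := leafWeight_one_zero k p
  have hp : 0 < 1 - p := by linarith
  have hl2 := isLaw_leafWeight k h0.le h1.le 2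
  have hpos2 : ∀ A, 0 < leafWeight k p 2 false A := 
    broadcast_false_pos (childWeight_leafWeight_pos k h0 h1 1) k
  -- The clear child contributes a likelihood ratio of at most `(1 - p) ^ k / p`, and each of the
  -- other `k - 1` children at most `1 / (1 - p)`. The product is `(1 - p) / p`, exactly cancelling
  -- the prior odds.
  have half : ∀ A : Fin k → Leaf k 1, (∃ i, A i = a₀) →
      p * leafWeight k p 2 true A ≤ (1 - p) * leafWeight k p 2 false A := by
    rintro A ⟨i, hi⟩
    have e1 : leafWeight k p 2 true A
        = (∏ j ∈ Finset.univ.erase i, w false (A j)) * w false (A i) :=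
      (Finset.prod_erase_mul _ _ (Finset.mem_univ i)).symm
    have e2 : leafWeight k p 2 false A
        = (∏ j ∈ Finset.univ.erase i, childWeight p w false (A j)) *
          childWeight p w false (A i) :=
      (Finset.prod_erase_mul _ _ (Finset.mem_univ i)).symm
    have hk : 0 < k := i.pos
    have e3 : (1 - p) ^ (k - 1) * ∏ j ∈ Finset.univ.erase i, w false (A j)
        ≤ ∏ j ∈ Finset.univ.erase i, childWeight p w false (A j) := by
      have : (1 - p) ^ (k - 1) = ∏ j ∈ Finset.univ.erase i, (1 - p) := by
        rw [Finset.prod_const, Finset.card_erase_of_mem (Finset.mem_univ i)]; simp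
      rw [this, ← Finset.prod_mul_distrib]
      refine Finset.prod_le_prod (fun j _ => mul_nonneg hp.le (hl.nonneg _ _)) fun j _ => ?_
      exact le_add_of_nonneg_right (mul_nonneg h0.le (hl.nonneg _ _))
    have e4 : p ≤ childWeight p w false (A i) := by
      rw [hi]
      simp only [childWeight, hw, ha₀, ht, hf]
      have := pow_pos hp k
      nlinarith
    have hP : 0 ≤ ∏ j ∈ Finset.univ.erase i, w false (A j) :=
      Finset.prod_nonneg fun j _ => hl.nonneg _ _
    have e5 : w false (A i) = (1 - p) * (1 - p) ^ (k - 1) := by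
      rw [hi, hw, ha₀, hf, ← pow_succ', Nat.sub_add_cancel hk]
    rw [e1, e2, e5]
    have e6 := mul_le_mul e3 e4 h0.le
      (le_trans (mul_nonneg (pow_nonneg hp.le _) hP) e3)
    have := mul_le_mul_of_nonneg_left e6 hp.le
    linarith
  have term : ∀ A : Fin k → Leaf k 1,
      p * (leafWeight k p 2 true A ^ 2 / childWeight p (leafWeight k p 2) false A)
        ≤ 1 / 2 * leafWeight k p 2 true A
          + 1 / 2 * ∏ i, (if A i = a₀ then 0 else w false (A i)) := by
    intro A
    have hT := hl2.nonneg true A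
    have hF := hpos2 A
    have hC : 0 < childWeight p (leafWeight k p 2) false A :=
      childWeight_leafWeight_pos k h0 h1 2 A
    have eC : childWeight p (leafWeight k p 2) false A
        = (1 - p) * leafWeight k p 2 false A + p * leafWeight k p 2 true A := rfl
    rw [← mul_div_assoc, div_le_iff₀ hC]
    by_cases h : ∃ i, A i = a₀
    · have := half A h
      have hz : ∏ i, (if A i = a₀ then 0 else w false (A i)) = 0 := by
        obtain ⟨i, hi⟩ := h
        exact Finset.prod_eq_zero (Finset.mem_univ i) (if_pos hi)
      rw [hz, eC]
      nlinarith
    · push Not at h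
      have hz : ∏ i, (if A i = a₀ then 0 else w false (A i)) = leafWeight k p 2 true A :=
        Finset.prod_congr rfl fun i _ => if_neg (h i)
      rw [hz, eC]
      have := mul_nonneg hT (mul_nonneg hp.le hF.le)
      nlinarith
  calc posteriorMean p (leafWeight k p 2)
      ≤ ∑ A : Fin k → Leaf k 1, (1 / 2 * leafWeight k p 2 true A
          + 1 / 2 * ∏ i, (if A i = a₀ then 0 else w false (A i))) :=
        Finset.sum_le_sum fun A _ => term A
    _ = 1 / 2 * ∑ A, leafWeight k p 2 true A
          + 1 / 2 * (∑ x, if x = a₀ then 0 else w false x) ^ k := by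
        rw [Finset.sum_add_distrib, ← sum_pi_prod_const, Finset.mul_sum, Finset.mul_sum]
        rfl
    _ = (1 + (1 - (1 - p) ^ k) ^ k) / 2 := by
        have e : ∑ x, (if x = a₀ then 0 else w false x) = 1 - (1 - p) ^ k := by
          have h2 := hl.sum_eq_one false
          rw [← Finset.add_sum_erase _ _ (Finset.mem_univ a₀)] at h2 ⊢
          rw [if_pos rfl, zero_add, Finset.sum_congr rfl fun x hx =>
            if_neg (Finset.ne_of_mem_erase hx), ← hf]
          linarith
        rw [e, hl2.sum_eq_one]; ring

end Recursion

/-! ### The law of a level of the tree -/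

theorem measurableSet_split {ι β Ω : Type*} [MeasurableSpace Ω] {m : ℕ} (i₀ : ι)
    (f : Fin m × β → ι) {E : Set Ω} (hE : MeasurableSet E) {T : Fin m → Set (β → Ω)}
    (hT : ∀ i, MeasurableSet (T i)) :
    MeasurableSet {U : ι → Ω | U i₀ ∈ E ∧ ∀ i, (fun u => U (f (i, u))) ∈ T i} := by
  have e : {U : ι → Ω | U i₀ ∈ E ∧ ∀ i, (fun u => U (f (i, u))) ∈ T i}
      = (fun U => U i₀) ⁻¹' E ∩ ⋂ i, (fun U u => U (f (i, u))) ⁻¹' T i := by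
    ext U; simp
  rw [e]
  refine (measurable_pi_apply i₀ hE).inter (MeasurableSet.iInter fun i => ?_)
  exact measurableSet_preimage (by fun_prop) (hT i)

/-- A coordinate of an infinite product is independent of disjoint families of coordinates, which
are independent of each other. -/
theorem infinitePi_split {ι β Ω : Type*} [MeasurableSpace Ω] (μ : Measure Ω)
    [IsProbabilityMeasure μ] {m : ℕ} (i₀ : ι) (f : Fin m × β → ι) (hf : Function.Injective f)
    (hi : i₀ ∉ Set.range f) {E : Set Ω} (hE : MeasurableSet E) {T : Fin m → Set (β → Ω)}
    (hT : ∀ i, MeasurableSet (T i)) :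
    Measure.infinitePi (fun _ : ι => μ) {U | U i₀ ∈ E ∧ ∀ i, (fun u => U (f (i, u))) ∈ T i}
      = μ E * ∏ i, Measure.infinitePi (fun _ : β => μ) (T i) := by
  set P := Measure.infinitePi (fun _ : ι => μ) with hP
  set Φ : (ι → Ω) → Fin m → β → Ω := fun U i u => U (f (i, u)) with hΦ
  have hind : ProbabilityTheory.iIndepFun (fun i (U : ι → Ω) => U i) P :=
    ProbabilityTheory.iIndepFun_infinitePi (P := fun _ : ι => μ) (X := fun _ x => x)
      fun _ => measurable_id
  -- Grouping coordinates separates `i₀` from the range of `f`; reindexing along `f` and currying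
  -- then separates the families from one another.
  have hsplit := ProbabilityTheory.indep_iSup_of_disjoint
    (m := fun i => MeasurableSpace.comap (fun U : ι → Ω => U i) inferInstance)
    (fun i => (measurable_pi_apply i).comap_le) hind
    (S := {i₀}) (T := Set.range f) (Set.disjoint_singleton_left.2 hi)
  rw [ProbabilityTheory.Indep_iff] at hsplit
  have hmeas : Measurable Φ := by fun_prop
  have hpi : MeasurableSet (Set.pi Set.univ T) := MeasurableSet.univ_pi hT
  have h1 := hsplit ((fun U => U i₀) ⁻¹' E) (Φ ⁻¹' Set.pi Set.univ T) ?_ ?_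
  · have e : {U : ι → Ω | U i₀ ∈ E ∧ ∀ i, (fun u => U (f (i, u))) ∈ T i}
        = (fun U => U i₀) ⁻¹' E ∩ Φ ⁻¹' Set.pi Set.univ T := by
      ext U; simp [hΦ, Set.mem_pi]
    rw [e, h1]
    congr 1
    · rw [← Measure.map_apply (measurable_pi_apply i₀) hE, hP, Measure.infinitePi_map_eval]
    · have hmap : P.map Φ
          = Measure.infinitePi fun _ : Fin m => Measure.infinitePi fun _ : β => μ := by
        rw [← Measure.infinitePi_map_curry (fun _ : Fin m => fun _ : β => μ),
          ← Measure.map_infinitePi_infinitePi_of_inj (P := fun _ : ι => μ) hf,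
          Measure.map_map (by fun_prop) (by fun_prop)]
        rfl
      rw [← Measure.map_apply hmeas hpi, hmap]
      have := Measure.infinitePi_pi (fun _ : Fin m => Measure.infinitePi fun _ : β => μ)
        (s := Finset.univ) (t := T) fun i _ => hT i
      rwa [Finset.coe_univ] at this
  · exact le_biSup (fun i => MeasurableSpace.comap (fun U : ι → Ω => U i) inferInstance)
      (Set.mem_singleton i₀) _ ⟨E, hE, rfl⟩
  · have : Measurable[⨆ i ∈ Set.range f,
        MeasurableSpace.comap (fun U : ι → Ω => U i) inferInstance] Φ := by
      refine @measurable_pi_lambda _ _ _ (_) _ _ fun i => ?_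
      refine @measurable_pi_lambda _ _ _ (_) _ _ fun u => ?_
      rw [measurable_iff_comap_le]
      exact le_biSup (fun i => MeasurableSpace.comap (fun U : ι → Ω => U i) inferInstance)
        (Set.mem_range_self (i, u))
    exact this hpi

theorem volume_decide_lt {q : ℝ} (h0 : 0 ≤ q) (h1 : q ≤ 1) (t : Bool) :
    (volume : Measure unitInterval) {u | decide ((u : ℝ) < q) = t}
      = ENNReal.ofReal (if t then q else 1 - q) := by
  cases t
  · have : {u : unitInterval | decide ((u : ℝ) < q) = false} = Set.Ici ⟨q, h0, h1⟩ := by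
      ext u; simp [← Subtype.coe_le_coe]
    rw [this, unitInterval.volume_Ici]; simp
  · have : {u : unitInterval | decide ((u : ℝ) < q) = true} = Set.Iio ⟨q, h0, h1⟩ := by
      ext u; simp [← Subtype.coe_lt_coe]
    rw [this, unitInterval.volume_Iio]; simp

theorem measurableSet_decide_lt (q : ℝ) (t : Bool) :
    MeasurableSet {u : unitInterval | decide ((u : ℝ) < q) = t} :=
  measurable_decide_lt measurable_subtype_coe measurable_const (measurableSet_singleton t)

instance instMeasurableSpaceLeaf (k n : ℕ) : MeasurableSpace (Leaf k n) := ⊤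

instance instDiscreteLeaf (k n : ℕ) : DiscreteMeasurableSpace (Leaf k n) := ⟨fun _ => trivial⟩

theorem measurable_leaf_succ {Ω : Type*} [MeasurableSpace Ω] {k n : ℕ}
    {F : Ω → Leaf k (n + 1)} (hF : ∀ j, Measurable fun x => (F x : Fin k → Leaf k n) j) :
    Measurable F := by
  refine measurable_to_countable' fun A => ?_
  have : F ⁻¹' {A} = ⋂ j, (fun x => (F x : Fin k → Leaf k n) j) ⁻¹'
      {(A : Fin k → Leaf k n) j} := by
    ext x
    simp only [Set.mem_preimage, Set.mem_singleton_iff, Set.mem_iInter]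
    exact funext_iff (f := (F x : Fin k → Leaf k n)) (g := A)
  rw [this]
  exact MeasurableSet.iInter fun j => hF j (measurableSet_singleton _)

/-- The spins `n` levels below a vertex of spin `s`, generated from the uniform variables of its
descendants, which are addressed by their position relative to the vertex. -/
def subtreeLeaf (k : ℕ) (α : ℝ) : (n : ℕ) → Bool → (List (Fin k) → unitInterval) → Leaf k n
  | 0, s, _ => s
  | n + 1, s, U => fun j =>
    subtreeLeaf k α n (decide ((U [j] : ℝ) < occProb α s)) fun u => U (u ++ [j])

theorem measurable_subtreeLeaf (k : ℕ) (α : ℝ) (n : ℕ) :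
    Measurable fun x : Bool × (List (Fin k) → unitInterval) => subtreeLeaf k α n x.1 x.2 := by
  induction n with
  | zero => exact measurable_to_countable' fun (b : Bool) => measurable_fst (measurableSet_singleton b)
  | succ n ih =>
    refine measurable_leaf_succ fun j => ?_
    have hocc : Measurable (occProb α) := measurable_of_finite _
    refine ih.comp (Measurable.prodMk ?_ ?_)
    · exact measurable_decide_lt (by fun_prop) (hocc.comp measurable_fst)
    · fun_prop

theorem measurable_subtreeLeaf_child (k : ℕ) (α : ℝ) (n : ℕ) (s : Bool) :
    Measurable fun U : List (Fin k) → unitInterval =>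
      subtreeLeaf k α n (decide ((U [] : ℝ) < occProb α s)) U :=
  (measurable_subtreeLeaf k α n).comp
    ((measurable_decide_lt (by fun_prop) measurable_const).prodMk measurable_id)

section OccProb

variable {α : ℝ}

theorem occProb_nonneg (h0 : 0 < α) (h1 : α < 1 / 2) (s : Bool) : 0 ≤ occProb α s := by
  cases s
  · exact div_nonneg h0.le (by linarith)
  · exact le_rfl

theorem occProb_le_one (h0 : 0 < α) (h1 : α < 1 / 2) (s : Bool) : occProb α s ≤ 1 := by
  cases s
  · exact (div_le_one (by linarith)).2 (by linarith)
  · exact zero_le_one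

theorem childWeight_eq {X : Type*} (α : ℝ) (w : Bool → X → ℝ) (s : Bool) (x : X) :
    childWeight (occProb α false) w s x
      = occProb α s * w true x + (1 - occProb α s) * w false x := by
  cases s <;> simp [childWeight, occProb]; ring

end OccProb

/-- The law of the spins below a child, given the spin `s` of its parent. -/
theorem subtreeLeaf_law (k : ℕ) {α : ℝ} (h0 : 0 < α) (h1 : α < 1 / 2) (n : ℕ) (s : Bool)
    (A : Leaf k n) :
    Measure.infinitePi (fun _ : List (Fin k) => (volume : Measure unitInterval))
        {U | subtreeLeaf k α n (decide ((U [] : ℝ) < occProb α s)) U = A}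
      = ENNReal.ofReal (childWeight (occProb α false) (leafWeight k (occProb α false) n) s A) := by
  have hq0 := occProb_nonneg h0 h1
  have hq1 := occProb_le_one h0 h1
  have hlaw := isLaw_leafWeight k (hq0 false) (hq1 false)
  induction n generalizing s with
  | zero =>
    change Bool at A
    have e : {U : List (Fin k) → unitInterval |
        subtreeLeaf k α 0 (decide ((U [] : ℝ) < occProb α s)) U = A}
        = (fun U => U []) ⁻¹' {u : unitInterval | decide ((u : ℝ) < occProb α s) = A} := rfl
    rw [e, ← Measure.map_apply (measurable_pi_apply ([] : List (Fin k)))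
      (measurableSet_decide_lt _ _), Measure.infinitePi_map_eval, volume_decide_lt (hq0 s) (hq1 s)]
    refine congrArg ENNReal.ofReal (Eq.trans ?_ (childWeight_eq α _ s _).symm)
    cases A <;> simp [leafWeight]
  | succ n ih =>
    change Fin k → Leaf k n at A
    set P := Measure.infinitePi (fun _ : List (Fin k) => (volume : Measure unitInterval)) with hP
    -- Split according to the spin `t` of the vertex itself; given `t`, the subtrees of its children
    -- use disjoint sets of variables.
    set Q : Bool → Set (List (Fin k) → unitInterval) := fun t =>
      {U | U [] ∈ {u : unitInterval | decide ((u : ℝ) < occProb α s) = t} ∧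
        ∀ j, (fun u => U (u ++ [j])) ∈ {V : List (Fin k) → unitInterval |
          subtreeLeaf k α n (decide ((V [] : ℝ) < occProb α t)) V = A j}} with hQ
    have hmT : ∀ t j, MeasurableSet {V : List (Fin k) → unitInterval |
          subtreeLeaf k α n (decide ((V [] : ℝ) < occProb α t)) V = A j} := fun t j =>
      measurable_subtreeLeaf_child k α n t (measurableSet_singleton (A j))
    have hQlaw : ∀ t, P (Q t) = ENNReal.ofReal ((if t then occProb α s else 1 - occProb α s) *
        leafWeight k (occProb α false) (n + 1) t A) := by
      intro t
      have hinj : Function.Injective fun x : Fin k × List (Fin k) => x.2 ++ [x.1] := by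
        rintro ⟨i, u⟩ ⟨j, v⟩ h
        have := List.append_inj' h rfl
        simp_all
      have := infinitePi_split (volume : Measure unitInterval) ([] : List (Fin k))
        (fun x : Fin k × List (Fin k) => x.2 ++ [x.1]) hinj (by simp)
        (measurableSet_decide_lt (occProb α s) t) (hmT t)
      refine this.trans ?_
      have hnn : 0 ≤ (if t then occProb α s else 1 - occProb α s) := by
        have := hq0 s
        have := hq1 s
        split_ifs <;> linarith
      rw [volume_decide_lt (hq0 s) (hq1 s), ENNReal.ofReal_mul hnn]
      congr 1
      rw [Finset.prod_congr rfl fun j _ => ih t (A j)]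
      exact (ENNReal.ofReal_prod_of_nonneg fun j _ =>
        ((hlaw n).child (hq0 false) (hq1 false)).nonneg t (A j)).symm
    have e : {U : List (Fin k) → unitInterval |
        subtreeLeaf k α (n + 1) (decide ((U [] : ℝ) < occProb α s)) U = A}
        = Q true ∪ Q false := by
      ext U
      have h2 : ∀ t, (subtreeLeaf k α (n + 1) t U = A ↔ ∀ j,
          subtreeLeaf k α n (decide ((U [j] : ℝ) < occProb α t)) (fun u => U (u ++ [j])) = A j) :=
        fun t => funext_iff (f := (subtreeLeaf k α (n + 1) t U : Fin k → Leaf k n)) (g := A)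
      simp only [Set.mem_ofPred_eq, Set.mem_union, hQ, h2, List.nil_append]
      cases decide ((U [] : ℝ) < occProb α s) <;> simp
    have hmQ : MeasurableSet (Q false) :=
      measurableSet_split [] (fun x : Fin k × List (Fin k) => x.2 ++ [x.1])
        (measurableSet_decide_lt (occProb α s) false) (hmT false)
    have hdisj : Disjoint (Q true) (Q false) := by
      rw [Set.disjoint_left]
      rintro U ⟨h2, _⟩ ⟨h3, _⟩
      simp only [Set.mem_ofPred_eq] at h2 h3
      rw [h2] at h3
      exact absurd h3 (by simp)
    rw [e, measure_union hdisj hmQ, hQlaw, hQlaw, ← ENNReal.ofReal_add]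
    · refine congrArg ENNReal.ofReal (Eq.trans ?_ (childWeight_eq α _ s _).symm)
      simp
    · exact mul_nonneg (by simpa using hq0 s) ((hlaw (n + 1)).nonneg _ _)
    · exact mul_nonneg (by simpa using hq1 s) ((hlaw (n + 1)).nonneg _ _)

/-- The spins of a configuration `n` levels below the vertex `some (i, w)`. -/
def readLeaf {d : ℕ} (σ : Config d) (i : Fin d) : (n : ℕ) → List (Fin (d - 1)) → Leaf (d - 1) n
  | 0, w => σ (some (i, w))
  | n + 1, w => fun j => readLeaf σ i n (j :: w)

/-- The spins of the vertices at distance `n + 1` from the root. -/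
def levelLeaves {d : ℕ} (n : ℕ) (σ : Config d) (i : Fin d) : Leaf (d - 1) n :=
  readLeaf σ i n []

theorem measurable_readLeaf {d : ℕ} (i : Fin d) (n : ℕ) (w : List (Fin (d - 1)))
    {m : MeasurableSpace (Config d)}
    (hm : ∀ u, depth (some (i, u)) = w.length + n + 1 → Measurable[m] fun σ => σ (some (i, u))) :
    Measurable[m] fun σ : Config d => readLeaf σ i n w := by
  induction n generalizing w with
  | zero =>
    exact measurable_to_countable' fun (b : Bool) =>
      hm w (by simp [depth]) (measurableSet_singleton b)
  | succ n ih =>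
    refine measurable_leaf_succ fun j => ih (j :: w) fun u hu => hm u ?_
    rw [hu, List.length_cons]; omega

theorem measurable_apply_of_readLeaf {d : ℕ} (i : Fin d) (n : ℕ) (u w : List (Fin (d - 1)))
    (hu : u.length = n) {m : MeasurableSpace (Config d)}
    (hm : Measurable[m] fun σ : Config d => readLeaf σ i n w) :
    Measurable[m] fun σ : Config d => σ (some (i, u ++ w)) := by
  induction n generalizing u w with
  | zero =>
    rw [List.length_eq_zero_iff] at hu
    subst hu
    exact measurable_to_countable' fun (b : Bool) => hm (measurableSet_singleton (α := Leaf _ 0) b)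
  | succ n ih =>
    -- Addresses are extended at the head, so the first descent of `readLeaf` is the last entry of
    -- `u`.
    rcases List.eq_nil_or_concat u with rfl | ⟨v, j, rfl⟩
    · simp at hu
    · have h2 : Measurable fun A : Leaf (d - 1) (n + 1) => (A : Fin (d - 1) → Leaf (d - 1) n) j :=
        Measurable.of_discrete
      have := ih v (j :: w) (by simpa using hu) (h2.comp hm)
      simpa using this

theorem levelSigma_eq_comap (d n : ℕ) :
    levelSigma d (n + 1) = MeasurableSpace.comap (levelLeaves (d := d) n) inferInstance := by
  apply le_antisymm
  · refine Measurable.comap_le (@measurable_pi_lambda _ _ _ (_) _ _ ?_)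
    rintro ⟨_ | ⟨i, w⟩, hv⟩
    · simp [depth] at hv
    · have hw : w.length = n := by simpa [depth] using hv
      have := measurable_apply_of_readLeaf i n w [] hw
        (m := MeasurableSpace.comap (levelLeaves (d := d) n) inferInstance)
        (Measurable.comp (g := fun A : Fin d → Leaf (d - 1) n => A i) (measurable_pi_apply i)
          (comap_measurable (levelLeaves n)))
      simpa using this
  · refine Measurable.comap_le (@measurable_pi_lambda _ _ _ (_) _ _ fun i => ?_)
    refine measurable_readLeaf i n [] fun u hu => ?_
    have h2 : depth (some (i, u)) = n + 1 := by rw [hu]; simp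
    exact Measurable.comp
      (g := fun B : {v : TreeVertex d // depth v = n + 1} → Bool => B ⟨some (i, u), h2⟩)
      (measurable_pi_apply _) (comap_measurable _)

theorem measurable_levelLeaves (d n : ℕ) : Measurable (levelLeaves (d := d) n) :=
  measurable_pi_lambda _ fun i => measurable_readLeaf i n [] fun _ _ => measurable_pi_apply _

theorem measurableSet_root (d : ℕ) (s : Bool) : MeasurableSet {σ : Config d | σ none = s} :=
  measurableSet_preimage (f := fun σ : Config d => σ none) (measurable_pi_apply none)
    (measurableSet_singleton s)

theorem readLeaf_treeSpin {d : ℕ} (α : ℝ) (U : TreeVertex d → unitInterval) (i : Fin d) (n : ℕ)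
    (w : List (Fin (d - 1))) :
    readLeaf (treeSpin α U) i n w
      = subtreeLeaf (d - 1) α n (branchSpin α U (decide ((U none : ℝ) < α)) i w)
          fun u => U (some (i, u ++ w)) := by
  induction n generalizing w with
  | zero => rfl
  | succ n ih =>
    funext j
    refine (ih (j :: w)).trans ?_
    simp [subtreeLeaf, branchSpin]

section TreeLaw

variable {d : ℕ} {α : ℝ}

theorem treeMeasure_root_level (h0 : 0 < α) (h1 : α < 1 / 2) (n : ℕ) (s : Bool)
    (A : Fin d → Leaf (d - 1) n) :
    (treeMeasure d α).real {σ | σ none = s ∧ levelLeaves n σ = A}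
      = (if s then α else 1 - α) * levelWeight d (occProb α false) n s A := by
  have hq0 := occProb_nonneg h0 h1
  have hq1 := occProb_le_one h0 h1
  have hmeas : MeasurableSet {σ : Config d | σ none = s ∧ levelLeaves n σ = A} :=
    MeasurableSet.inter (measurableSet_root d s)
      (measurable_levelLeaves d n (measurableSet_singleton A))
  have hinj : Function.Injective fun x : Fin d × List (Fin (d - 1)) => (some x : TreeVertex d) :=
    Option.some_injective _
  have e : treeSpin (d := d) α ⁻¹' {σ | σ none = s ∧ levelLeaves n σ = A}
      = {U | U none ∈ {u : unitInterval | decide ((u : ℝ) < α) = s} ∧ ∀ i : Fin d,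
          (fun u => U (some (i, u))) ∈ {V : List (Fin (d - 1)) → unitInterval |
            subtreeLeaf (d - 1) α n (decide ((V [] : ℝ) < occProb α s)) V = A i}} := by
    ext U
    simp only [Set.mem_preimage, Set.mem_ofPred_eq, treeSpin]
    refine and_congr_right fun hs => ?_
    rw [funext_iff]
    refine forall_congr' fun i => ?_
    rw [levelLeaves, readLeaf_treeSpin, hs]
    simp [branchSpin]
  have hmT : ∀ i : Fin d, MeasurableSet {V : List (Fin (d - 1)) → unitInterval |
      subtreeLeaf (d - 1) α n (decide ((V [] : ℝ) < occProb α s)) V = A i} := fun i =>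
    measurable_subtreeLeaf_child (d - 1) α n s (measurableSet_singleton (A i))
  have hnn : 0 ≤ (if s then α else 1 - α) := by split_ifs <;> linarith
  have hl := (isLaw_levelWeight d (hq0 false) (hq1 false) n).nonneg s A
  rw [measureReal_def, treeMeasure, Measure.map_apply (measurable_treeSpin α) hmeas, e,
    infinitePi_split (volume : Measure unitInterval) none _ hinj (by simp)
      (measurableSet_decide_lt α s) hmT,
    volume_decide_lt h0.le (by linarith) s,
    Finset.prod_congr rfl fun i _ => subtreeLeaf_law (d - 1) h0 h1 n s (A i),
    ← ENNReal.ofReal_prod_of_nonneg fun i _ =>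
      ((isLaw_leafWeight (d - 1) (hq0 false) (hq1 false) n).child (hq0 false)
        (hq1 false)).nonneg s (A i), ← ENNReal.ofReal_mul hnn]
  exact ENNReal.toReal_ofReal (mul_nonneg hnn hl)

theorem integral_root_level (h0 : 0 < α) (h1 : α < 1 / 2) (n : ℕ)
    (g : Bool × (Fin d → Leaf (d - 1) n) → ℝ) :
    ∫ σ, g (σ none, levelLeaves n σ) ∂(treeMeasure d α)
      = ∑ A, (α * levelWeight d (occProb α false) n true A * g (true, A)
          + (1 - α) * levelWeight d (occProb α false) n false A * g (false, A)) := by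
  have hm : Measurable fun σ : Config d => (σ none, levelLeaves n σ) :=
    (measurable_pi_apply none).prodMk (measurable_levelLeaves d n)
  rw [← integral_map (f := g) hm.aemeasurable (Measurable.of_discrete).aestronglyMeasurable,
    integral_fintype .of_finite, Fintype.sum_prod_type, Fintype.sum_bool,
    ← Finset.sum_add_distrib]
  have key : ∀ s A, ((treeMeasure d α).map fun σ : Config d => (σ none, levelLeaves n σ)).real
      {(s, A)} = (if s then α else 1 - α) * levelWeight d (occProb α false) n s A := by
    intro s A
    rw [← treeMeasure_root_level h0 h1, map_measureReal_apply hm (measurableSet_singleton _)]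
    congr 1
    ext σ
    simp [Prod.ext_iff]
  refine Finset.sum_congr rfl fun A _ => ?_
  rw [key, key]
  simp

/-- The posterior probability of an occupied root, as a function of the spins of a level. -/
def levelPosterior (d : ℕ) (α : ℝ) (n : ℕ) (A : Fin d → Leaf (d - 1) n) : ℝ :=
  α * levelWeight d (occProb α false) n true A
    / (α * levelWeight d (occProb α false) n true A
      + (1 - α) * levelWeight d (occProb α false) n false A)

theorem mul_levelPosterior (h0 : 0 < α) (h1 : α < 1 / 2) (n : ℕ) (A : Fin d → Leaf (d - 1) n) :
    (α * levelWeight d (occProb α false) n true A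
      + (1 - α) * levelWeight d (occProb α false) n false A) * levelPosterior d α n A
      = α * levelWeight d (occProb α false) n true A := by
  have hl := isLaw_levelWeight d (occProb_nonneg h0 h1 false) (occProb_le_one h0 h1 false) n
  have ht := mul_nonneg h0.le (hl.nonneg true A)
  have hf := mul_nonneg (show 0 ≤ 1 - α by linarith) (hl.nonneg false A)
  unfold levelPosterior
  -- On a level configuration of probability zero the quotient takes the default value 0, and the
  -- identity survives because the right side vanishes as well.
  rcases (add_nonneg ht hf).eq_or_lt with h | h
  · rw [← h, zero_mul]; linarith
  · field_simp

theorem levelPosterior_mem (h0 : 0 < α) (h1 : α < 1 / 2) (n : ℕ) (A : Fin d → Leaf (d - 1) n) :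
    0 ≤ levelPosterior d α n A ∧ levelPosterior d α n A ≤ 1 := by
  have hl := isLaw_levelWeight d (occProb_nonneg h0 h1 false) (occProb_le_one h0 h1 false) n
  have ht := mul_nonneg h0.le (hl.nonneg true A)
  have hf := mul_nonneg (show 0 ≤ 1 - α by linarith) (hl.nonneg false A)
  exact ⟨div_nonneg ht (add_nonneg ht hf), div_le_one_of_le₀ (by linarith) (add_nonneg ht hf)⟩

theorem rootPosterior_ae_eq (h0 : 0 < α) (h1 : α < 1 / 2) (n : ℕ) :
    (fun σ => levelPosterior d α n (levelLeaves n σ)) =ᵐ[treeMeasure d α]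
      rootPosterior d α (n + 1) := by
  have hroot := measurableSet_root d true
  have hpost : Measurable fun σ : Config d => levelPosterior d α n (levelLeaves n σ) :=
    (Measurable.of_discrete (f := levelPosterior d α n)).comp (measurable_levelLeaves d n)
  have hint : Integrable (fun σ => levelPosterior d α n (levelLeaves n σ)) (treeMeasure d α) :=
    Integrable.of_bound hpost.aestronglyMeasurable 1 (ae_of_all _ fun σ => by
      have := levelPosterior_mem h0 h1 n (levelLeaves n σ)
      rw [norm_eq_abs, abs_of_nonneg this.1]; exact this.2)
  refine ae_eq_condExp_of_forall_setIntegral_eq (levelSigma_le d (n + 1))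
    ((integrable_const _).indicator hroot) (fun s _ _ => hint.integrableOn) ?_ ?_
  · intro s hs _
    have hs' := levelSigma_le d (n + 1) s hs
    rw [levelSigma_eq_comap] at hs
    obtain ⟨T, -, rfl⟩ := hs
    classical
    rw [← integral_indicator hs', ← integral_indicator hs']
    have e1 : (levelLeaves n ⁻¹' T).indicator (fun σ : Config d =>
        levelPosterior d α n (levelLeaves n σ))
        = fun σ => (fun x : Bool × (Fin d → Leaf (d - 1) n) =>
          T.indicator (levelPosterior d α n) x.2) (σ none, levelLeaves n σ) := rfl
    have e2 : (levelLeaves n ⁻¹' T).indicator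
          ({σ : Config d | σ none = true}.indicator fun _ => (1 : ℝ))
        = fun σ => (fun x : Bool × (Fin d → Leaf (d - 1) n) =>
          T.indicator (fun _ => if x.1 = true then (1 : ℝ) else 0) x.2)
            (σ none, levelLeaves n σ) := by
      ext σ
      by_cases h2 : levelLeaves n σ ∈ T <;> by_cases h3 : σ none = true <;>
        simp [Set.indicator, h2, h3]
    rw [e1, e2, integral_root_level h0 h1, integral_root_level h0 h1]
    refine Finset.sum_congr rfl fun A _ => ?_
    by_cases h2 : A ∈ T
    · simp only [Set.indicator_of_mem h2, if_true]
      rw [← add_mul, mul_levelPosterior h0 h1]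
      simp
    · simp [Set.indicator_of_notMem h2]
  · refine StronglyMeasurable.aestronglyMeasurable (Measurable.stronglyMeasurable ?_)
    rw [levelSigma_eq_comap]
    exact (Measurable.of_discrete (f := levelPosterior d α n)).comp
      (comap_measurable (levelLeaves n))

/-- Multiplying by the probability of the level configuration clears Bayes' denominator and leaves
`α * (1 - α)` times the difference of the two conditional laws. -/
theorem integral_abs_posterior_sub (h0 : 0 < α) (h1 : α < 1 / 2) (n : ℕ) :
    ∫ σ, |levelPosterior d α n (levelLeaves n σ) - α| ∂(treeMeasure d α)
      = α * (1 - α) * rootGap d (occProb α false) n := by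
  have hl := isLaw_levelWeight d (occProb_nonneg h0 h1 false) (occProb_le_one h0 h1 false) n
  refine (integral_root_level h0 h1 n fun x => |levelPosterior d α n x.2 - α|).trans ?_
  rw [rootGap, Finset.mul_sum]
  refine Finset.sum_congr rfl fun A _ => ?_
  have ht := mul_nonneg h0.le (hl.nonneg true A)
  have hf := mul_nonneg (show 0 ≤ 1 - α by linarith) (hl.nonneg false A)
  have hc : 0 ≤ α * (1 - α) := mul_nonneg h0.le (by linarith)
  dsimp only
  rw [← add_mul, ← abs_of_nonneg (add_nonneg ht hf), ← abs_mul, mul_sub,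
    mul_levelPosterior h0 h1]
  rw [← abs_of_nonneg hc]
  rw [← abs_mul]
  congr 1
  ring

/-- The deviations lie in `[0, 1]`, so convergence in probability and in `L¹` coincide: Markov's
inequality one way, truncation at a small level the other. The shift from level `n + 1` to `n` does
not affect the limit. -/
theorem tendstoInMeasure_rootPosterior_iff (h0 : 0 < α) (h1 : α < 1 / 2) :
    TendstoInMeasure (treeMeasure d α) (rootPosterior d α) atTop (fun _ => α)
      ↔ Tendsto (rootGap d (occProb α false)) atTop (𝓝 0) := by
  set P := treeMeasure d α with hP
  set f : ℕ → Config d → ℝ := fun n σ => |levelPosterior d α n (levelLeaves n σ) - α| with hf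
  have hc : 0 < α * (1 - α) := mul_pos h0 (by linarith)
  have hfm : ∀ n, Measurable (f n) := fun n =>
    (Measurable.of_discrete (f := fun A => |levelPosterior d α n A - α|)).comp
      (measurable_levelLeaves d n)
  have hf1 : ∀ n σ, f n σ ≤ 1 := fun n σ => by
    have := levelPosterior_mem h0 h1 n (levelLeaves n σ)
    exact abs_le.2 ⟨by linarith, by linarith⟩
  have hf0 : ∀ n σ, 0 ≤ f n σ := fun n σ => abs_nonneg _
  have hfi : ∀ n, Integrable (f n) P := fun n =>
    Integrable.of_bound (hfm n).aestronglyMeasurable 1 (ae_of_all _ fun σ => by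
      rw [norm_eq_abs, abs_of_nonneg (hf0 n σ)]; exact hf1 n σ)
  have hE : ∀ n, ∫ σ, f n σ ∂P = α * (1 - α) * rootGap d (occProb α false) n :=
    integral_abs_posterior_sub h0 h1
  have hset : ∀ (ε : ℝ) n, P.real {σ | ε ≤ ‖rootPosterior d α (n + 1) σ - α‖}
      = P.real {σ | ε ≤ f n σ} := by
    intro ε n
    refine measureReal_congr ?_
    filter_upwards [rootPosterior_ae_eq (d := d) h0 h1 n] with σ hσ
    refine propext ?_
    change ε ≤ ‖rootPosterior d α (n + 1) σ - α‖ ↔ ε ≤ f n σ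
    rw [← hσ, norm_eq_abs]
  rw [tendstoInMeasure_iff_measureReal_norm]
  constructor
  · intro h
    rw [Metric.tendsto_atTop]
    intro ε hε
    have hδ : 0 < α * (1 - α) * ε / 2 := by positivity
    have h2 := (tendsto_add_atTop_iff_nat 1).2 (h _ hδ)
    simp only [hset] at h2
    obtain ⟨N, hN⟩ := (Metric.tendsto_atTop.1 h2) _ hδ
    refine ⟨N, fun n hn => ?_⟩
    have h3 := hN n hn
    rw [dist_zero_right, norm_eq_abs, abs_of_nonneg measureReal_nonneg] at h3
    rw [dist_zero_right, norm_eq_abs, abs_of_nonneg (rootGap_nonneg _ _ _)]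
    set δ := α * (1 - α) * ε / 2 with hδdef
    have hms : MeasurableSet {σ | δ ≤ f n σ} := measurableSet_le measurable_const (hfm n)
    have h4 : ∫ σ, f n σ ∂P ≤ ∫ σ, (δ + {σ | δ ≤ f n σ}.indicator (fun _ => (1 : ℝ)) σ) ∂P := by
      refine integral_mono (hfi n)
        ((integrable_const _).add ((integrable_const _).indicator hms)) fun σ => ?_
      by_cases h5 : δ ≤ f n σ
      · have : {σ | δ ≤ f n σ}.indicator (fun _ => (1 : ℝ)) σ = 1 := Set.indicator_of_mem
          (show σ ∈ {σ | δ ≤ f n σ} from h5) _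
        dsimp only
        rw [this]; linarith [hf1 n σ]
      · have : {σ | δ ≤ f n σ}.indicator (fun _ => (1 : ℝ)) σ = 0 := Set.indicator_of_notMem
          (show σ ∉ {σ | δ ≤ f n σ} from h5) _
        dsimp only
        rw [this]; linarith
    rw [integral_add (integrable_const _) ((integrable_const _).indicator hms),
      integral_indicator_const _ hms, hE] at h4
    simp only [integral_const, probReal_univ, smul_eq_mul, one_mul, mul_one] at h4
    have h5 : α * (1 - α) * rootGap d (occProb α false) n < α * (1 - α) * ε := by linarith
    exact lt_of_mul_lt_mul_left h5 hc.le
  · intro h ε hε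
    rw [← tendsto_add_atTop_iff_nat 1]
    simp only [hset]
    have h2 : Tendsto (fun n => α * (1 - α) * rootGap d (occProb α false) n / ε) atTop (𝓝 0) := by
      simpa using (h.const_mul (α * (1 - α))).div_const ε
    refine squeeze_zero (fun n => measureReal_nonneg) (fun n => ?_) h2
    rw [le_div_iff₀ hε, ← hE, mul_comm]
    exact mul_meas_ge_le_integral_of_nonneg (ae_of_all _ (hf0 n)) (hfi n) ε

end TreeLaw

/-! ### Monotonicity in the fugacity and existence of the threshold -/

theorem density_spec (d : ℕ) {lam : ℝ} (h : 0 < lam) :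
    0 < density d lam ∧ density d lam < 1 / 2 ∧ fugacity d (density d lam) = lam := by
  rw [density, dif_pos h]
  exact (existsUnique_density d h).choose_spec.1

theorem fugacity_pos (d : ℕ) {α : ℝ} (h0 : 0 < α) (h1 : α < 1 / 2) : 0 < fugacity d α :=
  mul_pos (div_pos h0 (by linarith)) (pow_pos (div_pos (by linarith) (by linarith)) _)

theorem density_fugacity (d : ℕ) {α : ℝ} (h0 : 0 < α) (h1 : α < 1 / 2) :
    density d (fugacity d α) = α := by
  have h := fugacity_pos d h0 h1
  exact (existsUnique_density d h).unique (density_spec d h) ⟨h0, h1, rfl⟩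

theorem fugacity_mono (d : ℕ) {a b : ℝ} (ha : 0 < a) (hab : a ≤ b) (hb : b < 1 / 2) :
    fugacity d a ≤ fugacity d b := by
  have h1 : 0 < 1 - 2 * a := by linarith
  have h2 : 0 < 1 - 2 * b := by linarith
  have e1 : a / (1 - 2 * a) ≤ b / (1 - 2 * b) := by
    rw [div_le_div_iff₀ h1 h2]; nlinarith
  have e2 : (1 - a) / (1 - 2 * a) ≤ (1 - b) / (1 - 2 * b) := by
    rw [div_le_div_iff₀ h1 h2]; nlinarith
  have p2 : 0 ≤ (1 - a) / (1 - 2 * a) := div_nonneg (by linarith) h1.le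
  exact mul_le_mul e1 (pow_le_pow_left₀ p2 e2 _) (pow_nonneg p2 _)
    (div_nonneg (by linarith) h2.le)

theorem density_mono (d : ℕ) {l l' : ℝ} (hl : 0 < l) (hll : l ≤ l') :
    density d l ≤ density d l' := by
  obtain ⟨a0, a1, a2⟩ := density_spec d hl
  obtain ⟨b0, b1, b2⟩ := density_spec d (hl.trans_le hll)
  by_contra! h
  have h2 := fugacity_mono d b0 h.le a1
  rw [a2, b2] at h2
  have h3 := le_antisymm hll h2
  rw [h3] at h
  exact lt_irrefl _ h

theorem nonReconstruction_iff {d : ℕ} {lam : ℝ} (h : 0 < lam) :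
    NonReconstruction d lam
      ↔ Tendsto (rootGap d (occProb (density d lam) false)) atTop (𝓝 0) :=
  tendstoInMeasure_rootPosterior_iff (density_spec d h).1 (density_spec d h).2.1

theorem NonReconstruction.anti {d : ℕ} {l l' : ℝ} (hl : 0 < l) (hll : l ≤ l')
    (h : NonReconstruction d l') : NonReconstruction d l := by
  rw [nonReconstruction_iff (hl.trans_le hll)] at h
  rw [nonReconstruction_iff hl]
  obtain ⟨a0, a1, -⟩ := density_spec d hl
  obtain ⟨b0, b1, -⟩ := density_spec d (hl.trans_le hll)
  refine squeeze_zero (fun n => rootGap_nonneg _ _ n) (fun n => ?_) h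
  refine rootGap_mono d (occProb_nonneg a0 a1 false) ?_ ?_ (occProb_le_one b0 b1 false) n
  · have := density_mono d hl hll
    exact div_le_div₀ b0.le this (by linarith) (by linarith)
  · exact div_pos b0 (by linarith)

/-- By `NonReconstruction.anti` the set of non-reconstruction fugacities is downward closed. The
density `a` makes it nonempty and `b` bounds it above, so its supremum is critical and lies between
them. -/
theorem critical_of_bounds {d : ℕ} {a b : ℝ} (ha : 0 < a) (ha1 : a < 1 / 2) (hb : 0 < b)
    (hb1 : b < 1 / 2) (hna : Tendsto (rootGap d (occProb a false)) atTop (𝓝 0))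
    (hnb : ¬ Tendsto (rootGap d (occProb b false)) atTop (𝓝 0)) :
    IsCriticalFugacity d (lambdaR d) ∧ fugacity d a ≤ lambdaR d ∧ lambdaR d ≤ fugacity d b ∧
      a ≤ alphaR d ∧ alphaR d ≤ b := by
  have hfa := fugacity_pos d ha ha1
  have hfb := fugacity_pos d hb hb1
  have hmem : fugacity d a ∈ {lam : ℝ | 0 < lam ∧ NonReconstruction d lam} :=
    ⟨hfa, (nonReconstruction_iff hfa).2 (by rwa [density_fugacity d ha ha1])⟩
  have hup : fugacity d b ∈ upperBounds {lam : ℝ | 0 < lam ∧ NonReconstruction d lam} := by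
    rintro l ⟨hl, hn⟩
    by_contra! h
    have h2 := (nonReconstruction_iff hfb).1 (hn.anti hfb h.le)
    rw [density_fugacity d hb hb1] at h2
    exact hnb h2
  have h1 : fugacity d a ≤ lambdaR d := le_csSup ⟨_, hup⟩ hmem
  have h2 : lambdaR d ≤ fugacity d b := csSup_le ⟨_, hmem⟩ hup
  have hpos := hfa.trans_le h1
  refine ⟨⟨hpos, fun l hl hlt => ?_, fun l hl hn => ?_⟩, h1, h2, ?_, ?_⟩
  · obtain ⟨l', ⟨_, hn⟩, hlt'⟩ := exists_lt_of_lt_csSup ⟨_, hmem⟩ hlt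
    exact hn.anti hl hlt'.le
  · exact hl.not_ge (le_csSup ⟨_, hup⟩ ⟨hpos.trans hl, hn⟩)
  · rw [← density_fugacity d ha ha1]
    exact density_mono d hfa h1
  · rw [← density_fugacity d hb hb1]
    exact density_mono d hpos h2

/-! ### Densities close to `(log d + log log d) / d` -/

/-- The density `(log d + log log d + c) / d`. -/
def nearDensity (c : ℝ) (d : ℕ) : ℝ := (log d + log (log d) + c) / d

theorem tendsto_log_natCast : Tendsto (fun d : ℕ => log (d : ℝ)) atTop atTop :=
  tendsto_log_atTop.comp tendsto_natCast_atTop_atTop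

theorem tendsto_log_pow_div (n : ℕ) : Tendsto (fun d : ℕ => log (d : ℝ) ^ n / d) atTop (𝓝 0) :=
  (isLittleO_pow_log_id_atTop (n := n)).tendsto_div_nhds_zero.comp tendsto_natCast_atTop_atTop

theorem tendsto_log_div_self : Tendsto (fun x : ℝ => log x / x) atTop (𝓝 0) :=
  isLittleO_log_id_atTop.tendsto_div_nhds_zero

section NearDensity

variable {c : ℕ → ℝ} (hc : Tendsto (fun d : ℕ => c d / log d) atTop (𝓝 0))
include hc

theorem tendsto_scaled_div_log :
    Tendsto (fun d : ℕ => (log d + log (log d) + c d) / log d) atTop (𝓝 1) := by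
  have h1 : Tendsto (fun d : ℕ => 1 + log (log d) / log d + c d / log d) atTop (𝓝 (1 + 0 + 0)) :=
    (tendsto_const_nhds.add (tendsto_log_div_self.comp tendsto_log_natCast)).add hc
  rw [add_zero, add_zero] at h1
  refine h1.congr' ?_
  filter_upwards [tendsto_log_natCast.eventually_gt_atTop 0] with d hd
  field_simp

theorem tendsto_nearDensity : Tendsto (fun d : ℕ => nearDensity (c d) d) atTop (𝓝 0) := by
  have h := (tendsto_scaled_div_log hc).mul (tendsto_log_pow_div 1)
  rw [mul_zero] at h
  refine h.congr' ?_
  filter_upwards [tendsto_log_natCast.eventually_gt_atTop 0] with d hd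
  simp only [nearDensity, pow_one]
  field_simp

/-- This is the size of the error made when the fugacity exponent or `growthRate` is replaced by `d
* α`. -/
theorem tendsto_mul_sq_nearDensity :
    Tendsto (fun d : ℕ => d * nearDensity (c d) d ^ 2) atTop (𝓝 0) := by
  have h := ((tendsto_scaled_div_log hc).pow 2).mul (tendsto_log_pow_div 2)
  rw [mul_zero] at h
  refine h.congr' ?_
  filter_upwards [tendsto_log_natCast.eventually_gt_atTop 0, eventually_gt_atTop 0] with d hd hd0
  have : (0 : ℝ) < d := by exact_mod_cast hd0
  simp only [nearDensity]
  field_simp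

theorem eventually_nearDensity_pos : ∀ᶠ d : ℕ in atTop, 0 < nearDensity (c d) d := by
  filter_upwards [(tendsto_scaled_div_log hc).eventually_const_lt zero_lt_one,
    tendsto_log_natCast.eventually_gt_atTop 0, eventually_gt_atTop 0] with d h1 h2 h3
  have h4 : (0 : ℝ) < d := by exact_mod_cast h3
  exact div_pos ((div_pos_iff_of_pos_right h2).1 h1) h4

theorem eventually_nearDensity_lt {η : ℝ} (hη : 0 < η) :
    ∀ᶠ d : ℕ in atTop, nearDensity (c d) d < η :=
  (tendsto_nearDensity hc).eventually_lt_const hη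

theorem tendsto_fugacity_exponent :
    Tendsto (fun d : ℕ => ((d - 1 : ℕ) : ℝ) *
      log ((1 - nearDensity (c d) d) / (1 - 2 * nearDensity (c d) d)) - d * nearDensity (c d) d)
      atTop (𝓝 0) := by
  have ha := tendsto_nearDensity hc
  have hlo : Tendsto (fun d : ℕ => -nearDensity (c d) d) atTop (𝓝 0) := by simpa using ha.neg
  have hhi : Tendsto (fun d : ℕ => (-nearDensity (c d) d + 2 * (d * nearDensity (c d) d ^ 2))
      / (1 - 2 * nearDensity (c d) d)) atTop (𝓝 0) := by
    have := (ha.neg.add ((tendsto_mul_sq_nearDensity hc).const_mul 2)).div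
      ((ha.const_mul 2).const_sub 1) (by norm_num)
    simpa [Pi.div_def] using this
  refine tendsto_of_tendsto_of_tendsto_of_le_of_le' hlo hhi ?_ ?_
  all_goals
    filter_upwards [eventually_nearDensity_pos hc,
      eventually_nearDensity_lt hc (show (0 : ℝ) < 1 / 4 by norm_num),
      eventually_ge_atTop 1] with d h0 h1 hd
    set a := nearDensity (c d) d
    have h2 : 0 < 1 - 2 * a := by linarith
    have h3 : 0 < (1 - a) / (1 - 2 * a) := div_pos (by linarith) h2
    have hd1 : (1 : ℝ) ≤ d := by exact_mod_cast hd
    rw [Nat.cast_sub hd, Nat.cast_one]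
  · have h4 := one_sub_inv_le_log_of_pos h3
    have h5 : a ≤ 1 - ((1 - a) / (1 - 2 * a))⁻¹ := by
      have : 1 - ((1 - a) / (1 - 2 * a))⁻¹ = a / (1 - a) := by
        have : 1 - a ≠ 0 := by linarith
        field_simp; ring
      rw [this, le_div_iff₀ (by linarith)]
      nlinarith
    nlinarith [mul_le_mul_of_nonneg_left (h5.trans h4) (sub_nonneg.2 hd1)]
  · have h4 := log_le_sub_one_of_pos h3
    have h5 : (1 - a) / (1 - 2 * a) - 1 = a / (1 - 2 * a) := by
      rw [div_sub_one h2.ne']; congr 1; ring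
    rw [h5] at h4
    have h6 := mul_le_mul_of_nonneg_left h4 (sub_nonneg.2 hd1)
    have h7 : (-a + 2 * (d * a ^ 2)) / (1 - 2 * a) = (d - 1) * (a / (1 - 2 * a)) - d * a := by
      rw [← mul_div_assoc, div_sub' h2.ne']; congr 1; ring
    linarith

/-- The fugacity behaves like `α * exp (d * α)`, where `α` is asymptotic to `log d / d` and `exp (d
* α) = d * log d * exp c`. -/
theorem tendsto_fugacity_div :
    Tendsto (fun d : ℕ => fugacity d (nearDensity (c d) d) / (log d ^ 2 * exp (c d))) atTop
      (𝓝 1) := by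
  have ha := tendsto_nearDensity hc
  have h := ((tendsto_scaled_div_log hc).mul
    ((continuous_exp.tendsto 0).comp (tendsto_fugacity_exponent hc))).div
      ((ha.const_mul 2).const_sub 1) (by norm_num)
  rw [exp_zero, mul_zero, sub_zero, mul_one, div_one] at h
  refine h.congr' ?_
  filter_upwards [eventually_nearDensity_pos hc,
    eventually_nearDensity_lt hc (show (0 : ℝ) < 1 / 4 by norm_num), eventually_ge_atTop 1,
    tendsto_log_natCast.eventually_gt_atTop 0] with d h0 h1 hd hL
  have hd0 : (0 : ℝ) < d := by exact_mod_cast hd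
  have hda : (d : ℝ) * nearDensity (c d) d = log d + log (log d) + c d := by
    simp only [nearDensity]; field_simp
  have hx : exp (log d + log (log d) + c d) = d * log d * exp (c d) := by
    rw [exp_add, exp_add, exp_log hd0, exp_log hL]
  simp only [Pi.div_apply, Function.comp_apply]
  set a := nearDensity (c d) d
  have h2 : 0 < 1 - 2 * a := by linarith
  have h3 : 0 < (1 - a) / (1 - 2 * a) := div_pos (by linarith) h2
  rw [exp_sub, hda, hx, exp_nat_mul, exp_log h3, fugacity, ← hda]
  have := exp_pos (c d)
  field_simp

theorem tendsto_growthRate_sub :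
    Tendsto (fun d : ℕ => growthRate (d - 1) (occProb (nearDensity (c d) d) false)
      - (log d + log (log d) + c d)) atTop (𝓝 0) := by
  have ha := tendsto_nearDensity hc
  have h := (((tendsto_mul_sq_nearDensity hc).mul ((ha.const_mul 4).const_sub 3)).sub
    (ha.mul (ha.const_sub 1))).div (((ha.const_mul 2).const_sub 1).pow 2) (by norm_num)
  simp only [mul_zero, zero_mul, sub_zero, zero_div] at h
  refine h.congr' ?_
  filter_upwards [eventually_nearDensity_pos hc,
    eventually_nearDensity_lt hc (show (0 : ℝ) < 1 / 4 by norm_num),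
    eventually_ge_atTop 1] with d h0 h1 hd
  have hd0 : (0 : ℝ) < d := by exact_mod_cast hd
  have hda : (d : ℝ) * nearDensity (c d) d = log d + log (log d) + c d := by
    simp only [nearDensity]; field_simp
  rw [← hda]
  simp only [Pi.div_apply, growthRate, occProb, Nat.cast_sub hd, Nat.cast_one]
  set a := nearDensity (c d) d
  have h2 : 1 - 2 * a ≠ 0 := by linarith
  have h3 : 1 - a ≠ 0 := by linarith
  have h4 : 1 - a / (1 - a) = (1 - 2 * a) / (1 - a) := by field_simp; ring
  have h5 : ((d : ℝ) - 1) * (a / (1 - a)) / ((1 - 2 * a) / (1 - a)) ^ 2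
      = (d - 1) * a * (1 - a) / (1 - 2 * a) ^ 2 := by
    generalize 1 - 2 * a = b at h2
    field_simp
  rw [h4, h5, div_sub' (pow_ne_zero 2 h2)]
  congr 1
  ring

end NearDensity

/-! ### Reconstruction -/

/-- The error rates are `ε = 1 / log d` and `δ = 1 / (k * log d)` with `k = d - 1`, so `k * δ = ε`;
`hp` makes `exp (-(k * p * (1 - ε)))` at most `1 / (d * log d)`, which closes the recursion. -/
theorem not_tendsto_rootGap_of_bounds {d : ℕ} (hd : 2 ≤ d) {p : ℝ} (h0 : 0 ≤ p) (h1 : p ≤ 1)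
    (hL : 8 ≤ log (d : ℝ))
    (hp : log d + log (log d) ≤ ((d - 1 : ℕ) : ℝ) * (p * (1 - 1 / log d))) :
    ¬ Tendsto (rootGap d p) atTop (𝓝 0) := by
  set L := log (d : ℝ) with hLdef
  set k : ℕ := d - 1 with hk
  have hd0 : (0 : ℝ) < d := by exact_mod_cast (by omega : 0 < d)
  have hkd : (k : ℝ) + 1 = d := by exact_mod_cast (by omega : k + 1 = d)
  have hk1 : (1 : ℝ) ≤ k := by exact_mod_cast (by omega : 1 ≤ k)
  have hL0 : 0 < L := by linarith
  have hL1 : 1 / L ≤ 1 / 8 := one_div_le_one_div_of_le (by norm_num) hL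
  have hL2 : 0 < 1 / L := by positivity
  have hb0 : 0 ≤ 1 - p * (1 - 1 / L) := by nlinarith
  have hb1 : 1 - p * (1 - 1 / L) ≤ 1 := by nlinarith
  have hstep : (1 - p * (1 - 1 / L)) ^ k ≤ 1 / (k * L) := by
    calc (1 - p * (1 - 1 / L)) ^ k ≤ exp (-(p * (1 - 1 / L))) ^ k :=
          pow_le_pow_left₀ hb0 (one_sub_le_exp_neg _) k
      _ = exp (-(k * (p * (1 - 1 / L)))) := by rw [← exp_nat_mul]; congr 1; ring
      _ ≤ exp (-(L + log L)) := exp_le_exp.2 (by linarith)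
      _ = 1 / (d * L) := by
          rw [exp_neg, exp_add, exp_log hL0, hLdef, exp_log hd0, one_div]
      _ ≤ 1 / (k * L) := by
          apply one_div_le_one_div_of_le (by positivity)
          exact mul_le_mul_of_nonneg_right (by linarith) hL0.le
  have hkL : 1 / (k * L) ≤ 1 / 8 := by
    apply one_div_le_one_div_of_le (by norm_num); nlinarith
  have hbound : ∀ n, 1 / 2 ≤ rootGap d p n := by
    intro n
    refine le_trans ?_ (rootGap_lower_bound d h0 h1 hL2.le
      (by positivity : 0 ≤ 1 / (k * L)) (by linarith)
      (le_of_eq (by rw [← hk]; field_simp)) hstep n)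
    have h2 : (1 - p * (1 - 1 / L)) ^ d ≤ 1 / 8 :=
      ((pow_le_pow_of_le_one hb0 hb1 (by omega : k ≤ d)).trans hstep).trans hkL
    have h3 : (d : ℝ) * (1 / (k * L)) ≤ 1 / 4 := by
      rw [← hkd, mul_one_div, div_le_iff₀ (by positivity)]; nlinarith
    linarith
  intro h
  have := ge_of_tendsto' h hbound
  norm_num at this

theorem eventually_not_tendsto_rootGap {ε : ℝ} (hε : 0 < ε) :
    ∀ᶠ d : ℕ in atTop,
      ¬ Tendsto (rootGap d (occProb (nearDensity (1 + ε) d) false)) atTop (𝓝 0) := by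
  have hc : Tendsto (fun d : ℕ => (1 + ε) / log (d : ℝ)) atTop (𝓝 0) :=
    tendsto_const_nhds.div_atTop tendsto_log_natCast
  have ha := tendsto_nearDensity (c := fun _ => 1 + ε) hc
  -- The factor `1 - 1 / log d` costs `1 + o(1)` out of the offset `1 + ε`, leaving a surplus that
  -- tends to `ε`.
  have hlim : Tendsto (fun d : ℕ => ε - nearDensity (1 + ε) d - (log (log d) / log d +
      (1 + ε) / log d)) atTop (𝓝 ε) := by
    simpa using (ha.const_sub ε).sub ((tendsto_log_div_self.comp tendsto_log_natCast).add hc)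
  filter_upwards [hlim.eventually_const_lt hε, eventually_ge_atTop 2,
    tendsto_log_natCast.eventually_ge_atTop 8, eventually_nearDensity_pos hc,
    eventually_nearDensity_lt hc (show (0 : ℝ) < 1 / 4 by norm_num)] with d h1 hd hL h0 h2
  have hd0 : (0 : ℝ) < d := by exact_mod_cast (by omega : 0 < d)
  have hda : (d : ℝ) * nearDensity (1 + ε) d = log d + log (log d) + (1 + ε) := by
    simp only [nearDensity]; field_simp
  set a := nearDensity (1 + ε) d
  refine not_tendsto_rootGap_of_bounds hd (occProb_nonneg h0 (by linarith) false)
    (occProb_le_one h0 (by linarith) false) hL ?_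
  have hap : a ≤ occProb a false := by
    simp only [occProb]; rw [le_div_iff₀ (by linarith)]; nlinarith
  have hL1 : 1 / log (d : ℝ) ≤ 1 / 8 := one_div_le_one_div_of_le (by norm_num) hL
  have hd1 : (1 : ℝ) ≤ d := by exact_mod_cast (by omega : 1 ≤ d)
  have hL0 : log (d : ℝ) ≠ 0 := by linarith
  calc log d + log (log d)
      ≤ (d * a - a) * (1 - 1 / log d) := by
        rw [hda]
        have e : (log d + log (log d) + (1 + ε) - a) * (1 - 1 / log d)
            - (log d + log (log d))
            = (ε - a - (log (log d) / log d + (1 + ε) / log d)) + a / log d := by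
          field_simp; ring
        have : 0 ≤ a / log (d : ℝ) := div_nonneg h0.le (by linarith)
        linarith
    _ = (d - 1) * (a * (1 - 1 / log d)) := by ring
    _ ≤ ((d - 1 : ℕ) : ℝ) * (occProb a false * (1 - 1 / log d)) := by
        rw [Nat.cast_sub (by omega), Nat.cast_one]
        exact mul_le_mul_of_nonneg_left (mul_le_mul_of_nonneg_right hap (by linarith))
          (by linarith)

/-! ### Non-reconstruction -/

/-- The size conditions on `L = log d` under which the magnetization is shown to decay. -/
structure IsLarge (L : ℝ) : Prop where
  four_le : 4 ≤ L
  log_le : log L ≤ L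
  loglog_nonneg : 0 ≤ log (log L)
  log_nonneg : 0 ≤ log L
  ratio_le : 2.6 * (log L / L) ≤ 1 / 12
  gap : 4 * log L ≤ L / (1 + 4 * exp (0.8 * log L))
  decay : 4 * L ^ 2 * exp ((log L - L) / 2) ≤ 1
  contraction : 16 * L ^ 2 * exp (-L) ≤ 1

theorem eventually_isLarge : ∀ᶠ L : ℝ in atTop, IsLarge L := by
  -- With `u = log L` this reads `20 * log L ≤ L ^ 0.2`, which compares `L / L ^ 0.8` with `log L`
  -- in the field `gap`.
  have hgap : ∀ᶠ u : ℝ in atTop, 20 * u ≤ exp (0.2 * u) := by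
    have h := (tendsto_pow_mul_exp_neg_atTop_nhds_zero 1).comp
      (tendsto_id.const_mul_atTop (show (0 : ℝ) < 0.2 by norm_num))
    filter_upwards [h.eventually_le_const (show (0 : ℝ) < 1 / 100 by norm_num)] with u hu
    simp only [Function.comp_apply, id, pow_one] at hu
    have e : exp (-(0.2 * u)) * exp (0.2 * u) = 1 := by rw [← exp_add]; simp
    nlinarith [exp_pos (0.2 * u)]
  have hdecay := (tendsto_pow_mul_exp_neg_atTop_nhds_zero 3).comp
      (tendsto_id.const_mul_atTop (show (0 : ℝ) < 1 / 2 by norm_num))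
  filter_upwards [eventually_ge_atTop 4,
    (tendsto_log_atTop.comp tendsto_log_atTop).eventually_ge_atTop 0,
    tendsto_log_div_self.eventually_le_const (show (0 : ℝ) < 1 / 40 by norm_num),
    tendsto_log_atTop.eventually hgap,
    hdecay.eventually_le_const (show (0 : ℝ) < 1 / 32 by norm_num),
    (tendsto_pow_mul_exp_neg_atTop_nhds_zero 2).eventually_le_const
      (show (0 : ℝ) < 1 / 16 by norm_num)] with L h4 hll hr hg hd hc
  have hL : 0 < L := by linarith
  have hlog : 0 ≤ log L := log_nonneg (by linarith)
  have hle : log L ≤ L := (log_le_sub_one_of_pos hL).trans (by linarith)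
  refine ⟨h4, hle, hll, hlog, by linarith, ?_, ?_, by linarith⟩
  · have hS : 1 ≤ exp (0.8 * log L) := one_le_exp (by positivity)
    rw [le_div_iff₀ (by positivity)]
    have e : exp (0.8 * log L) * exp (0.2 * log L) = L := by
      rw [← exp_add, ← add_mul]; norm_num [exp_log hL]
    calc 4 * log L * (1 + 4 * exp (0.8 * log L))
        ≤ 4 * log L * (5 * exp (0.8 * log L)) :=
          mul_le_mul_of_nonneg_left (by linarith) (by linarith)
      _ = exp (0.8 * log L) * (20 * log L) := by ring
      _ ≤ exp (0.8 * log L) * exp (0.2 * log L) :=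
          mul_le_mul_of_nonneg_left hg (exp_pos _).le
      _ = L := e
  · have e : exp ((log L - L) / 2) = exp (log L / 2) * exp (-(1 / 2 * L)) := by
      rw [← exp_add]; congr 1; ring
    have e2 : exp (log L / 2) ≤ L := by
      calc exp (log L / 2) ≤ exp (log L) := exp_le_exp.2 (by linarith)
        _ = L := exp_log hL
    simp only [Function.comp_apply, id] at hd
    rw [e]
    calc 4 * L ^ 2 * (exp (log L / 2) * exp (-(1 / 2 * L)))
        ≤ 4 * L ^ 2 * (L * exp (-(1 / 2 * L))) := by gcongr
      _ = 32 * ((1 / 2 * L) ^ 3 * exp (-(1 / 2 * L))) := by ring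
      _ ≤ 1 := by linarith

section Decay

variable {k : ℕ} {p L : ℝ}

theorem exp_neg_growthRate_le (h0 : 0 < p) (h1 : p < 1) :
    exp (-growthRate k p) ≤ (1 - p) ^ k := by
  have hp : 0 < 1 - p := by linarith
  have h2 : exp (-(p / (1 - p) ^ 2)) ≤ 1 - p := by
    rw [← le_log_iff_exp_le hp]
    have h3 := one_sub_inv_le_log_of_pos hp
    have h4 : 1 - (1 - p)⁻¹ = -(p / (1 - p)) := by field_simp; ring
    have h5 : p / (1 - p) ≤ p / (1 - p) ^ 2 := by
      apply div_le_div_of_nonneg_left h0.le (by positivity)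
      nlinarith
    linarith
  calc exp (-growthRate k p) = exp (-(p / (1 - p) ^ 2)) ^ k := by
        rw [← exp_nat_mul]; congr 1; simp only [growthRate]; ring
    _ ≤ (1 - p) ^ k := pow_le_pow_left₀ (exp_pos _).le h2 k

theorem posteriorMean_succ_le_of_mul_exp_le (h0 : 0 < p) (h2 : p ≤ 1 / 2) (n : ℕ) {B S : ℝ}
    (hB : growthRate k p * posteriorMean p (leafWeight k p n) ≤ B) (hS : p * exp B ≤ 2 * S) :
    posteriorMean p (leafWeight k p (n + 1)) ≤ 1 - 1 / (1 + 4 * S) := by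
  refine (posteriorMean_succ_le_of_exp_le h0 (by linarith) n (exp_le_exp.2 hB)).trans ?_
  have hS0 : 0 < S := by have := mul_pos h0 (exp_pos B); linarith
  have h3 : 0 < p * exp B := mul_pos h0 (exp_pos B)
  have h4 : 1 / (1 + 4 * S) ≤ (1 - p) / (1 - p + p * exp B) := by
    rw [div_le_div_iff₀ (by linarith) (by linarith)]
    nlinarith
  linarith

/-- With `q = (1 - p) ^ k`, the expected number `k * q` of clear children is at least `2.6 * log L /
L`: the `-1` in `hg` supplies a factor `e > 2.7`, and `k ≥ 26 / 27 * exp L`. Passing to the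
probability of a clear child costs a factor `12 / 13`, and halving leaves `1.2`. -/
theorem posteriorMean_two_le_of_growthRate_le (h0 : 0 < p) (h1 : p < 1) (hL : IsLarge L)
    (hk : (k : ℝ) + 1 = exp L)
    (hg : growthRate k p ≤ L + log L - log (log L) - 1) :
    posteriorMean p (leafWeight k p 2) ≤ 1 - 1.2 * (log L / L) := by
  have hL0 : 0 < L := by linarith [hL.four_le]
  have hlog : 0 < log L := log_pos (by linarith [hL.four_le])
  refine (posteriorMean_two_le h0 h1).trans ?_
  set q := (1 - p) ^ k with hq
  set t := 2.6 * (log L / L) with ht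
  have ht0 : 0 ≤ t := by positivity
  have hexpL : 30 ≤ exp L := by
    have h4 : exp 1 ^ 4 ≤ exp L := by
      rw [← exp_nat_mul]; exact exp_le_exp.2 (by push_cast; linarith [hL.four_le])
    have h5 : (2.7 : ℝ) ^ 4 ≤ exp 1 ^ 4 :=
      pow_le_pow_left₀ (by norm_num) (by linarith [exp_one_gt_d9]) 4
    refine le_trans ?_ (h5.trans h4)
    norm_num
  have hkq : t ≤ k * q := by
    have h3 : exp (-(L + log L - log (log L) - 1)) ≤ q :=
      (exp_le_exp.2 (by linarith)).trans (exp_neg_growthRate_le h0 h1)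
    have h4 : exp (-(L + log L - log (log L) - 1)) = exp 1 * (log L / L) / exp L := by
      rw [show -(L + log L - log (log L) - 1) = 1 + log (log L) - log L - L by ring, exp_sub,
        exp_sub, exp_add, exp_log hlog, exp_log hL0]
      ring
    rw [h4, div_le_iff₀ (exp_pos L)] at h3
    have h5 : 2.7 * (log L / L) ≤ exp 1 * (log L / L) :=
      mul_le_mul_of_nonneg_right (by linarith [exp_one_gt_d9]) (by positivity)
    have hq0 : 0 ≤ q := pow_nonneg (by linarith) k
    have h6 : 26 / 27 * exp L ≤ k := by linarith
    have h7 := mul_le_mul_of_nonneg_left h6 hq0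
    rw [ht]
    linarith
  have hq1 : q ≤ 1 := pow_le_one₀ (by linarith) (by linarith)
  have hpow : (1 - q) ^ k ≤ exp (-t) := by
    calc (1 - q) ^ k ≤ exp (-q) ^ k :=
          pow_le_pow_left₀ (by linarith) (one_sub_le_exp_neg q) k
      _ = exp (-(k * q)) := by rw [← exp_nat_mul]; congr 1; ring
      _ ≤ exp (-t) := exp_le_exp.2 (by linarith)
  have hexp : exp (-t) ≤ 1 - 12 / 13 * t := by
    have h3 : 1 + t ≤ exp t := by linarith [add_one_le_exp t]
    have h4 : exp (-t) * exp t = 1 := by rw [← exp_add]; simp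
    have h5 : 1 ≤ (1 - 12 / 13 * t) * (1 + t) := by nlinarith [hL.ratio_le]
    have h6 : 0 ≤ 1 - 12 / 13 * t := by linarith [hL.ratio_le]
    have h7 := mul_le_mul_of_nonneg_left h3 h6
    exact le_of_mul_le_mul_right (by linarith) (exp_pos t)
  have hexp' := hpow.trans hexp
  rw [ht] at hexp'
  linarith

/-- A bootstrap over levels 2 to 5. What matters is that `1.2 > 1`: the gain at level 2 brings the
exponent from `L + log L` below `L`, after which each step improves the bound sharply. -/
theorem tendsto_posteriorMean_of_growthRate_le (h0 : 0 < p) (h2 : p ≤ 1 / 2) (hL : IsLarge L)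
    (hk : (k : ℝ) + 1 = exp L) (hp : p ≤ 2 * L * exp (-L))
    (hg : growthRate k p ≤ L + log L - log (log L) - 1) :
    Tendsto (fun n => posteriorMean p (leafWeight k p n)) atTop (𝓝 p) := by
  have h1 : p < 1 := by linarith
  have hL4 := hL.four_le
  have hL0 : 0 < L := by linarith
  have hκ : growthRate k p ≤ L + log L := by linarith [hL.loglog_nonneg]
  have hκ0 : 0 ≤ growthRate k p := by
    have : 0 < 1 - p := by linarith
    unfold growthRate; positivity
  have hpexp : ∀ x, p * exp (L + x) ≤ 2 * (L * exp x) := by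
    intro x
    have e : exp (-L) * exp L = 1 := by rw [← exp_add]; simp
    calc p * exp (L + x) ≤ 2 * L * exp (-L) * exp (L + x) :=
          mul_le_mul_of_nonneg_right hp (exp_pos _).le
      _ = 2 * (L * exp x) * (exp (-L) * exp L) := by rw [exp_add]; ring
      _ = 2 * (L * exp x) := by rw [e, mul_one]
  have hz2 := posteriorMean_two_le_of_growthRate_le h0 h1 hL hk hg
  -- The exponent is at most `L - 0.2 * log L`, so `p * exp` of it is at most `2 * L ^ 0.8`.
  have hz3 : posteriorMean p (leafWeight k p 3) ≤ 1 - 1 / (1 + 4 * exp (0.8 * log L)) := by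
    refine posteriorMean_succ_le_of_mul_exp_le (B := L + -(0.2 * log L)) h0 h2 2 ?_ ?_
    · have h3 : 0 ≤ 1 - 1.2 * (log L / L) := by
        linarith [hL.ratio_le, div_nonneg hL.log_nonneg hL0.le]
      have e : (L + log L) * (1 - 1.2 * (log L / L))
          = L - 0.2 * log L - 1.2 * log L * (log L / L) := by field_simp; ring
      have h4 : 0 ≤ 1.2 * log L * (log L / L) :=
        mul_nonneg (mul_nonneg (by norm_num) hL.log_nonneg) (div_nonneg hL.log_nonneg hL0.le)
      calc growthRate k p * posteriorMean p (leafWeight k p 2)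
          ≤ growthRate k p * (1 - 1.2 * (log L / L)) := mul_le_mul_of_nonneg_left hz2 hκ0
        _ ≤ (L + log L) * (1 - 1.2 * (log L / L)) := mul_le_mul_of_nonneg_right hκ h3
        _ ≤ L + -(0.2 * log L) := by rw [e]; linarith
    · refine (hpexp _).trans_eq ?_
      congr 1
      nth_rw 1 [← exp_log hL0]
      rw [← exp_add]
      congr 1
      ring
  -- The distance of level 3 from 1 is of order at least `L ^ (-0.8)`; multiplied by `L` this
  -- exceeds `4 * log L`, so the exponent drops to `L - 3 * log L`.
  have hz4 : posteriorMean p (leafWeight k p 4)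
      ≤ 1 - 1 / (1 + 4 * (L * exp (-(3 * log L)))) := by
    refine posteriorMean_succ_le_of_mul_exp_le (B := L + -(3 * log L)) h0 h2 3 ?_ (hpexp _)
    have hgap := hL.gap
    have hS0 := exp_pos (0.8 * log L)
    set S := exp (0.8 * log L)
    have hS : 0 < 1 + 4 * S := by positivity
    have h3 : 0 ≤ 1 - 1 / (1 + 4 * S) := by
      rw [sub_nonneg, div_le_one hS]; linarith
    have h4 : 0 ≤ log L / (1 + 4 * S) := div_nonneg hL.log_nonneg hS.le
    calc growthRate k p * posteriorMean p (leafWeight k p 3)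
        ≤ growthRate k p * (1 - 1 / (1 + 4 * S)) := mul_le_mul_of_nonneg_left hz3 hκ0
      _ ≤ (L + log L) * (1 - 1 / (1 + 4 * S)) := mul_le_mul_of_nonneg_right hκ h3
      _ = L + log L - L / (1 + 4 * S) - log L / (1 + 4 * S) := by ring
      _ ≤ L + -(3 * log L) := by linarith
  have hz4' : posteriorMean p (leafWeight k p 4) ≤ 1 / 2 := by
    have e : L * exp (-(3 * log L)) = 1 / L ^ 2 := by
      rw [exp_neg, show (3 : ℝ) * log L = ((3 : ℕ) : ℝ) * log L by norm_num, exp_nat_mul,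
        exp_log hL0]
      field_simp
    have h3 : 1 / L ^ 2 ≤ 1 / 4 := one_div_le_one_div_of_le (by norm_num) (by nlinarith)
    have h4 : 1 / 2 ≤ 1 / (1 + 4 * (1 / L ^ 2)) :=
      one_div_le_one_div_of_le (by positivity) (by linarith)
    rw [e] at hz4
    linarith
  refine tendsto_posteriorMean h0 h1 5 ?_ ?_
  · have h3 : growthRate k p * (posteriorMean p (leafWeight k p 4) - p)
        ≤ L + (log L - L) / 2 := by
      calc growthRate k p * (posteriorMean p (leafWeight k p 4) - p)
          ≤ growthRate k p * (1 / 2) := mul_le_mul_of_nonneg_left (by linarith) hκ0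
        _ ≤ L + (log L - L) / 2 := by linarith
    have h4 : posteriorMean p (leafWeight k p 5) - p
        ≤ 2 * (L * exp ((log L - L) / 2)) := by
      refine (posteriorMean_succ_sub_le h0 h1 4).trans (le_trans ?_ (hpexp _))
      exact mul_le_mul_of_nonneg_left (by linarith [exp_le_exp.2 h3]) h0.le
    have h5 : 0 ≤ 2 * (L * exp ((log L - L) / 2)) := by positivity
    calc growthRate k p * (posteriorMean p (leafWeight k p 5) - p)
        ≤ growthRate k p * (2 * (L * exp ((log L - L) / 2))) :=
          mul_le_mul_of_nonneg_left h4 hκ0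
      _ ≤ 2 * L * (2 * (L * exp ((log L - L) / 2))) :=
          mul_le_mul_of_nonneg_right (by linarith [hL.log_le]) h5
      _ = 4 * L ^ 2 * exp ((log L - L) / 2) := by ring
      _ ≤ 1 := hL.decay
  · calc 4 * p * growthRate k p ≤ 4 * (2 * L * exp (-L)) * (2 * L) :=
          mul_le_mul (by linarith) (by linarith [hL.log_le]) hκ0 (by positivity)
      _ = 16 * L ^ 2 * exp (-L) := by ring
      _ ≤ 1 := hL.contraction

end Decay

theorem tendsto_lowerOffset_div_log : Tendsto (fun d : ℕ =>
    (-log (log (log d)) - log 2 + log (log 2)) / log d) atTop (𝓝 0) := by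
  have h1 : Tendsto (fun x : ℝ => log (log x) / x) atTop (𝓝 0) := by
    have h := (tendsto_log_div_self.comp tendsto_log_atTop).mul tendsto_log_div_self
    rw [mul_zero] at h
    refine h.congr' ?_
    filter_upwards [tendsto_log_atTop.eventually_gt_atTop 0] with x hx
    simp only [Function.comp_apply]
    field_simp
  have h2 : Tendsto (fun x : ℝ => (-log 2 + log (log 2)) / x) atTop (𝓝 0) :=
    tendsto_const_nhds.div_atTop tendsto_id
  have h3 := (h1.neg.add h2).comp tendsto_log_natCast
  rw [neg_zero, add_zero] at h3
  refine h3.congr fun d => ?_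
  simp only [Function.comp_apply]
  ring

theorem eventually_tendsto_rootGap : ∀ᶠ d : ℕ in atTop,
    Tendsto (rootGap d (occProb (nearDensity (-log (log (log d)) - log 2 + log (log 2)) d) false))
      atTop (𝓝 0) := by
  have hc := tendsto_lowerOffset_div_log
  -- Equivalent to `log 2 < 2 / e`: the constant in the offset is below `-1`, with room to absorb
  -- the error in `growthRate`.
  have hconst : 0 < -1 - (-log 2 + log (log 2)) := by
    have h2 : 0 < log 2 := log_pos (by norm_num)
    have h3 : log (log 2) < log (2 * exp (-1)) := by
      apply log_lt_log h2
      have e : exp 1 * exp (-1) = 1 := by rw [← exp_add]; simp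
      nlinarith [exp_one_lt_d9, exp_pos (-1), log_two_lt_d9]
    rw [log_mul (by norm_num) (exp_pos _).ne', log_exp] at h3
    linarith
  filter_upwards [eventually_nearDensity_pos hc,
    eventually_nearDensity_lt hc (show (0 : ℝ) < 1 / 4 by norm_num), eventually_ge_atTop 1,
    tendsto_log_natCast.eventually eventually_isLarge,
    (tendsto_growthRate_sub hc).eventually_lt_const hconst,
    (tendsto_scaled_div_log hc).eventually_lt_const (show (1 : ℝ) < 3 / 2 by norm_num)]
    with d h0 h1 hd hL hg hs
  have hd0 : (0 : ℝ) < d := by exact_mod_cast hd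
  have hL0 : 0 < log (d : ℝ) := by linarith [hL.four_le]
  have hpos : 0 < occProb (nearDensity (-log (log (log d)) - log 2 + log (log 2)) d) false :=
    div_pos h0 (by linarith)
  have hda : nearDensity (-log (log (log d)) - log 2 + log (log 2)) d ≤ 3 / 2 * (log d / d) := by
    rw [div_lt_iff₀ hL0] at hs
    rw [nearDensity, ← mul_div_assoc]
    exact div_le_div_of_nonneg_right hs.le hd0.le
  have hhalf : occProb (nearDensity (-log (log (log d)) - log 2 + log (log 2)) d) false
      ≤ 1 / 2 := by
    simp only [occProb]
    rw [div_le_iff₀ (by linarith)]; linarith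
  have hp2 : occProb (nearDensity (-log (log (log d)) - log 2 + log (log 2)) d) false
      ≤ 2 * log d * exp (-log d) := by
    rw [exp_neg, exp_log hd0]
    simp only [occProb]
    rw [div_le_iff₀ (by linarith), mul_assoc 2, ← div_eq_mul_inv]
    have : 0 < log (d : ℝ) / d := by positivity
    nlinarith
  refine tendsto_rootGap hpos (by linarith)
    (tendsto_posteriorMean_of_growthRate_le hpos hhalf hL ?_ hp2 ?_)
  · rw [exp_log hd0, Nat.cast_sub hd]; simp
  · linarith

end Hardcore

/-! ### Assembly of the bounds -/

theorem theorem2 :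
    (∀ᶠ d : ℕ in atTop, Hardcore.IsCriticalFugacity d (Hardcore.lambdaR d)) ∧
    (∃ ε₁ ε₂ : ℕ → ℝ, Tendsto ε₁ atTop (𝓝 0) ∧ Tendsto ε₂ atTop (𝓝 0) ∧
      ∀ᶠ d : ℕ in atTop,
        (log 2 - ε₁ d) * log d ^ 2 / (2 * log (log d)) ≤ Hardcore.lambdaR d ∧
        Hardcore.lambdaR d ≤ (exp 1 + ε₂ d) * log d ^ 2) ∧
    (∃ ε₁ ε₂ : ℕ → ℝ, Tendsto ε₁ atTop (𝓝 0) ∧ Tendsto ε₂ atTop (𝓝 0) ∧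
      ∀ᶠ d : ℕ in atTop,
        1 / (d : ℝ) * (log d + log (log d) - log (log (log d)) - log 2 + log (log 2) - ε₁ d)
          ≤ Hardcore.alphaR d ∧
        Hardcore.alphaR d ≤ 1 / (d : ℝ) * (log d + log (log d) + 1 + ε₂ d)) := by
  have hlow := Hardcore.tendsto_lowerOffset_div_log
  have hup : ∀ ε : ℝ, Tendsto (fun d : ℕ => (1 + ε) / log (d : ℝ)) atTop (𝓝 0) := fun ε =>
    tendsto_const_nhds.div_atTop Hardcore.tendsto_log_natCast
  have hmain : ∀ ε : ℝ, 0 < ε → ∀ᶠ d : ℕ in atTop,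
      Hardcore.IsCriticalFugacity d (Hardcore.lambdaR d) ∧
      Hardcore.fugacity d (Hardcore.nearDensity (-log (log (log d)) - log 2 + log (log 2)) d)
        ≤ Hardcore.lambdaR d ∧
      Hardcore.lambdaR d ≤ Hardcore.fugacity d (Hardcore.nearDensity (1 + ε) d) ∧
      Hardcore.nearDensity (-log (log (log d)) - log 2 + log (log 2)) d ≤ Hardcore.alphaR d ∧
      Hardcore.alphaR d ≤ Hardcore.nearDensity (1 + ε) d := by
    intro ε hε
    filter_upwards [Hardcore.eventually_nearDensity_pos hlow,
      Hardcore.eventually_nearDensity_lt hlow (show (0 : ℝ) < 1 / 2 by norm_num),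
      Hardcore.eventually_nearDensity_pos (hup ε),
      Hardcore.eventually_nearDensity_lt (hup ε) (show (0 : ℝ) < 1 / 2 by norm_num),
      Hardcore.eventually_tendsto_rootGap, Hardcore.eventually_not_tendsto_rootGap hε]
      with d h1 h2 h3 h4 h5 h6
    exact Hardcore.critical_of_bounds h1 h2 h3 h4 h5 h6
  have hloglog : Tendsto (fun d : ℕ => log (log (d : ℝ))) atTop atTop :=
    tendsto_log_atTop.comp Hardcore.tendsto_log_natCast
  -- The error terms are the positive parts of the actual defects, so eventual upper bounds by every
  -- `ε > 0` suffice.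
  have hzero : ∀ u : ℕ → ℝ, (∀ ε : ℝ, 0 < ε → ∀ᶠ d in atTop, u d ≤ ε) →
      Tendsto (fun d => max 0 (u d)) atTop (𝓝 0) := by
    intro u hu
    rw [tendsto_order]
    refine ⟨fun a ha => Eventually.of_forall fun d => ha.trans_le (le_max_left _ _),
      fun a ha => ?_⟩
    filter_upwards [hu (a / 2) (by linarith)] with d hd
    exact max_lt ha (by linarith)
  refine ⟨(hmain 1 one_pos).mono fun d h => h.1,
    ⟨fun d => max 0 (log 2 - Hardcore.lambdaR d * (2 * log (log d)) / log d ^ 2),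
      fun d => max 0 (Hardcore.lambdaR d / log d ^ 2 - exp 1), hzero _ fun ε hε => ?_,
      hzero _ fun ε hε => ?_, ?_⟩,
    ⟨fun _ => 0, fun d => max 0 (d * Hardcore.alphaR d - (log d + log (log d) + 1)),
      tendsto_const_nhds, hzero _ fun ε hε => ?_, ?_⟩⟩
  · have h2 : 0 < log 2 := log_pos (by norm_num)
    have hlim := (Hardcore.tendsto_fugacity_div hlow).mul_const (log 2)
    rw [one_mul] at hlim
    filter_upwards [hlim.eventually_const_lt (show log 2 - ε < log 2 by linarith), hmain 1 one_pos,
      Hardcore.tendsto_log_natCast.eventually_gt_atTop 0, hloglog.eventually_gt_atTop 0]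
      with d h3 h4 h5 h6
    -- The offset is the logarithm of the required factor `log 2 / (2 * log log d)`.
    have e : exp (-log (log (log (d : ℝ))) - log 2 + log (log 2))
        = log 2 / (2 * log (log (d : ℝ))) := by
      rw [exp_add, exp_sub, exp_neg, exp_log h6, exp_log two_pos, exp_log h2]
      field_simp
    have h7 : Hardcore.fugacity d
        (Hardcore.nearDensity (-log (log (log d)) - log 2 + log (log 2)) d)
          / (log d ^ 2 * exp (-log (log (log (d : ℝ))) - log 2 + log (log 2))) * log 2
        = Hardcore.fugacity d
        (Hardcore.nearDensity (-log (log (log d)) - log 2 + log (log 2)) d)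
          * (2 * log (log d)) / log d ^ 2 := by
      rw [e]; field_simp
    rw [h7] at h3
    have h8 : Hardcore.fugacity d
        (Hardcore.nearDensity (-log (log (log d)) - log 2 + log (log 2)) d)
          * (2 * log (log d)) / log d ^ 2
        ≤ Hardcore.lambdaR d * (2 * log (log d)) / log d ^ 2 :=
      div_le_div_of_nonneg_right (mul_le_mul_of_nonneg_right h4.2.1 (by linarith)) (by positivity)
    linarith
  · obtain ⟨η, hη, hη2⟩ : ∃ η : ℝ, 0 < η ∧ exp (1 + η) < exp 1 + ε := by
      have hcont : Tendsto (fun η : ℝ => exp (1 + η)) (𝓝[>] 0) (𝓝 (exp (1 + 0))) :=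
        ((by fun_prop : Continuous fun η : ℝ => exp (1 + η)).tendsto 0).mono_left
          nhdsWithin_le_nhds
      rw [add_zero] at hcont
      obtain ⟨η, h1, h2⟩ := ((hcont.eventually_lt_const
        (show exp 1 < exp 1 + ε by linarith)).and self_mem_nhdsWithin).exists
      exact ⟨η, h2, h1⟩
    have hlim := (Hardcore.tendsto_fugacity_div (hup η)).mul_const (exp (1 + η))
    rw [one_mul] at hlim
    filter_upwards [hlim.eventually_lt_const hη2, hmain η hη,
      Hardcore.tendsto_log_natCast.eventually_gt_atTop 0] with d h3 h4 h5
    have h6 : Hardcore.fugacity d (Hardcore.nearDensity (1 + η) d)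
          / (log d ^ 2 * exp (1 + η)) * exp (1 + η)
        = Hardcore.fugacity d (Hardcore.nearDensity (1 + η) d) / log d ^ 2 := by
      have := exp_pos (1 + η)
      field_simp
    rw [h6] at h3
    have h7 : Hardcore.lambdaR d / log d ^ 2
        ≤ Hardcore.fugacity d (Hardcore.nearDensity (1 + η) d) / log d ^ 2 :=
      div_le_div_of_nonneg_right h4.2.2.1 (by positivity)
    linarith
  · filter_upwards [Hardcore.tendsto_log_natCast.eventually_gt_atTop 0,
      hloglog.eventually_gt_atTop 0] with d h5 h6
    have h7 : 0 < log (d : ℝ) ^ 2 := by positivity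
    constructor
    · rw [div_le_iff₀ (by linarith), ← le_div_iff₀ h7]
      linarith [le_max_right 0 (log 2 - Hardcore.lambdaR d * (2 * log (log d)) / log d ^ 2)]
    · rw [← div_le_iff₀ h7]
      linarith [le_max_right 0 (Hardcore.lambdaR d / log d ^ 2 - exp 1)]
  · filter_upwards [hmain ε hε, eventually_ge_atTop 1] with d h hd
    have hd0 : (0 : ℝ) < d := by exact_mod_cast hd
    have h2 := h.2.2.2.2
    rw [Hardcore.nearDensity, le_div_iff₀ hd0] at h2
    linarith
  · filter_upwards [hmain 1 one_pos, eventually_ge_atTop 1] with d h hd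
    have hd0 : (0 : ℝ) < d := by exact_mod_cast hd
    constructor
    · refine le_trans (le_of_eq ?_) h.2.2.2.1
      rw [Hardcore.nearDensity]; ring
    · rw [one_div, inv_mul_eq_div, le_div_iff₀ hd0]
      linarith [le_max_right 0 (d * Hardcore.alphaR d - (log d + log (log (d : ℝ)) + 1))]

end
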